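/- Let $R$ be a regular local ring with maximal ideal $\mathfrak m$, residue field $\mathbb K=R/\mathfrak m$, regular system of parameters $x=(x_1,\dots,x_n)$ and $\mathfrak m$-adic completion $\widehat R$ (again regular local, with residue field $\mathbb K$ and regular system of parameters $x$). Let $S$ be $R$ or $\widehat R$. Every $f\in S$ has a finite expansion $f=\sum_A\rho_A x^A$, $A\in\mathbb Z_{\ge 0}^n$, $\rho_A\in S^\times\cup\{0\}$. The Newton polyhedron $\mathrm{NP}(f)\subset\mathbb R^n_{\ge 0}$ is the smallest closed convex set containing $\{A\mid \rho_A\ne 0\}+\mathbb R_{\ge 0}^n$. A compact face of $\mathrm{NP}(f)$ is a non-empty set of the form $\{v\in \mathrm{NP}(f)\mid L(v)=\min_{\mathrm{NP}(f)}L\}$ with $L(v)=\lambda_1v_1+\dots+\lambda_nv_n$, all $\lambda_i>0$; a loose edge is a compact face of dimension one that is not contained in any compact face of dimension $\ge 2$. For a compact face $F$ of $\mathrm{NP}(f)$, the initial form of $f$ along $F$ is $\mathrm{in}_F(f)=\sum_{A\in F}\overline{\rho_A}X^A\in\mathbb K[X_1,\dots,X_n]$, where $\overline{\rho_A}$ is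 the residue class of $\rho_A$. (Neither $\mathrm{NP}(f)$ nor $\mathrm{in}_F(f)$ depends on the expansion.) **Theorem 1.1.** Let $f\in R$ be such that $\mathrm{NP}(f)$ has a loose edge $\mathcal E$. Suppose that $\mathrm{in}_{\mathcal E}(f)=G\cdot H$ with coprime polynomials $G,H\in\mathbb K[X_1,\dots,X_n]$ (no common non-constant factor), where $G$ is not divisible by any of the variables $X_1,\dots,X_n$. Then there exist $\widehat g,\widehat h\in\widehat R$ with $$f=\widehat g\cdot\widehat h\quad\text{in }\widehat R,$$ and compact faces $\mathcal E_1$ of $\mathrm{NP}(\widehat g)$ and $\mathcal E_2$ of $\mathrm{NP}(\widehat h)$, each of dimension at most one, such that $\mathrm{in}_{\mathcal E_1}(\widehat g)=G$, $\mathrm{in}_{\mathcal E_2}(\widehat h)=H$ and $\mathcal E=\mathcal E_1+\mathcal E_2$ (Minkowski sum). -/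

import Mathlib

open scoped Pointwise
open IsLocalRing

/-- `x` is a regular system of parameters of the local ring `R`: it generates the maximal ideal
and has as many members as the dimension of `R`. -/
structure IsRegularSystemOfParameters {R : Type*} [CommRing R] [IsLocalRing R] {n : ℕ}
    (x : Fin n → R) : Prop where
  span_eq : Ideal.span (Set.range x) = maximalIdeal R
  dim_eq : ringKrullDim R = (n : WithBot ℕ∞)

/-- The point of `ℝⁿ` given by an exponent. -/
def exponentPoint {n : ℕ} (A : Fin n →₀ ℕ) : Fin n → ℝ := fun i => (A i : ℝ)

/-- A finite expansion `f = ∑ ρ_A x^A` with every `ρ_A` a unit or zero. The family of the `ρ_A` is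
recorded as the polynomial `ρ = ∑ ρ_A X^A`, so that `f` is the value of `ρ` at `x`. -/
structure IsExpansion {R : Type*} [CommRing R] {n : ℕ} (x : Fin n → R) (f : R)
    (ρ : MvPolynomial (Fin n) R) : Prop where
  isUnit_coeff : ∀ A ∈ ρ.support, IsUnit (ρ.coeff A)
  eval_eq : MvPolynomial.eval x ρ = f

/-- The Newton polyhedron of an expansion: the smallest closed convex set that contains
`{A | ρ_A ≠ 0} + ℝⁿ_{≥ 0}`. In a regular local ring with regular system of parameters `x` it is
the same for all expansions of an element. -/
def newtonPolyhedron {R : Type*} [CommRing R] {n : ℕ} (ρ : MvPolynomial (Fin n) R) :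
    Set (Fin n → ℝ) :=
  closedConvexHull ℝ (exponentPoint '' (ρ.support : Set (Fin n →₀ ℕ)) + {v | ∀ i, 0 ≤ v i})

/-- The linear form `v ↦ ⟨l, v⟩` on `ℝⁿ`. -/
def linForm {n : ℕ} (l v : Fin n → ℝ) : ℝ := ∑ i, l i * v i

/-- The face of `Δ` cut out by a linear form: the points of `Δ` where it is minimal on `Δ`. -/
def faceOf {n : ℕ} (Δ : Set (Fin n → ℝ)) (l : Fin n → ℝ) : Set (Fin n → ℝ) :=
  {v | v ∈ Δ ∧ ∀ w ∈ Δ, linForm l v ≤ linForm l w}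

/-- A compact face: a non-empty face cut out by a linear form with positive coefficients. -/
def IsCompactFace {n : ℕ} (Δ F : Set (Fin n → ℝ)) : Prop :=
  F.Nonempty ∧ ∃ l : Fin n → ℝ, (∀ i, 0 < l i) ∧ F = faceOf Δ l

/-- The dimension of (the affine span of) a subset of `ℝⁿ`. -/
noncomputable def faceDim {n : ℕ} (F : Set (Fin n → ℝ)) : ℕ :=
  Module.finrank ℝ (vectorSpan ℝ F)

/-- A loose edge of `Δ`: a compact face of dimension one that is contained in no compact face
of dimension at least two. -/
structure IsLooseEdge {n : ℕ} (Δ E : Set (Fin n → ℝ)) : Prop where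
  isCompactFace : IsCompactFace Δ E
  faceDim_eq_one : faceDim E = 1
  loose : ∀ F, IsCompactFace Δ F → E ⊆ F → ¬ 2 ≤ faceDim F

open Classical in
/-- The initial form of an expansion along a compact face `F` of its Newton polyhedron:
the sum of the terms `ρ̄_A X^A` with `A ∈ F`, where `ρ̄_A` is the residue class of `ρ_A`.
See `initialForm_eq_of_linForm` for its description by a positive linear form defining `F`. -/
noncomputable def initialForm {R : Type*} [CommRing R] [IsLocalRing R] {n : ℕ}
    (ρ : MvPolynomial (Fin n) R) (F : Set (Fin n → ℝ)) :
    MvPolynomial (Fin n) (ResidueField R) :=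
  ∑ A ∈ ρ.support with exponentPoint A ∈ F, MvPolynomial.monomial A (residue R (ρ.coeff A))

/-- `F` is a compact face of the Newton polyhedron of `g`, and `P` is the initial form of `g`
along `F`. This is required of every expansion of `g`, together with the existence of one. -/
def HasInitialFormAlong {R : Type*} [CommRing R] [IsLocalRing R] {n : ℕ} (x : Fin n → R) (g : R)
    (F : Set (Fin n → ℝ)) (P : MvPolynomial (Fin n) (ResidueField R)) : Prop :=
  (∃ ρ, IsExpansion x g ρ) ∧
    ∀ ρ, IsExpansion x g ρ → IsCompactFace (newtonPolyhedron ρ) F ∧ initialForm ρ F = P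

theorem exponentPoint_mem_newtonPolyhedron {R : Type*} [CommRing R] {n : ℕ}
    {ρ : MvPolynomial (Fin n) R} {A : Fin n →₀ ℕ} (hA : A ∈ ρ.support) :
    exponentPoint A ∈ newtonPolyhedron ρ :=
  subset_closedConvexHull ⟨_, ⟨A, hA, rfl⟩, 0, fun _ => le_rfl, add_zero _⟩

theorem exponentPoint_mem_faceOf_iff {R : Type*} [CommRing R] {n : ℕ}
    {ρ : MvPolynomial (Fin n) R} {A : Fin n →₀ ℕ} (hA : A ∈ ρ.support) {l : Fin n → ℝ}
    (hl : ∀ i, 0 < l i) :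
    exponentPoint A ∈ faceOf (newtonPolyhedron ρ) l ↔
      ∀ B ∈ ρ.support, linForm l (exponentPoint A) ≤ linForm l (exponentPoint B) := by
  constructor
  · intro h B hB
    exact h.2 _ (exponentPoint_mem_newtonPolyhedron hB)
  · intro h
    refine ⟨exponentPoint_mem_newtonPolyhedron hA, ?_⟩
    have hlin : IsLinearMap ℝ (linForm l) := by
      constructor
      · intro v w
        simp [linForm, mul_add, Finset.sum_add_distrib]
      · intro c v
        simp only [linForm, Pi.smul_apply, smul_eq_mul, Finset.mul_sum]
        exact Finset.sum_congr rfl fun i _ => by ring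
    have hcont : Continuous (linForm l) := by unfold linForm; fun_prop
    have hsub : newtonPolyhedron ρ ⊆ {w | linForm l (exponentPoint A) ≤ linForm l w} := by
      refine closedConvexHull_min ?_ (convex_halfSpace_ge hlin _)
        (isClosed_le continuous_const hcont)
      rintro _ ⟨_, ⟨B, hB, rfl⟩, v, hv, rfl⟩
      have hv' : 0 ≤ linForm l v := Finset.sum_nonneg fun i _ => mul_nonneg (hl i).le (hv i)
      have := h B hB
      simp only [Set.mem_ofPred_eq, hlin.map_add]
      linarith
    exact fun w hw => hsub hw

open Classical in
/-- Along the face defined by a positive linear form `L`, the initial form is the sum of the terms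
`ρ̄_A X^A` with `L(A)` minimal among the exponents of the expansion. -/
theorem initialForm_eq_of_linForm {R : Type*} [CommRing R] [IsLocalRing R] {n : ℕ}
    (ρ : MvPolynomial (Fin n) R) {l : Fin n → ℝ} (hl : ∀ i, 0 < l i) :
    initialForm ρ (faceOf (newtonPolyhedron ρ) l) =
      ∑ A ∈ ρ.support with
        ∀ B ∈ ρ.support, linForm l (exponentPoint A) ≤ linForm l (exponentPoint B),
        MvPolynomial.monomial A (residue R (ρ.coeff A)) := by
  unfold initialForm
  congr 1
  exact Finset.filter_congr fun A hA => exponentPoint_mem_faceOf_iff hA hl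

/-!
Let `c` be the primitive direction of the loose edge `E`, and `A₀` an exponent on `E`. Looseness
means that, seen along `c`, the Newton polyhedron of `f` has a single vertex: all exponents of `f`
lie in the cone `A₀ + ℝ c + ℝⁿ_{≥ 0}` (`IsLooseEdge.exists_direction`). Membership in this cone is
tested by the weights in `ℕⁿ` orthogonal to `c`, and both factors `G`, `H` of the initial form are
homogeneous for all these weights, hence are supported on lines parallel to `c`: they come from
polynomials `g`, `h` in one variable `T`, where `T` stands for `X^c`
(`IsEdgeDirection.exists_eq_lineForm`).

Since `G` and `H` are coprime, so are `g` and `h`, and since no variable divides `G`, its exponents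
start at `deg g • c⁻`. A monomial `X^D` of the cone is then a combination of `G` and `H`
(`IsEdgeDirection.exists_monomial_eq`): on the line `D + ℤ c` this is a division with remainder by
`g`, and the cone condition is exactly what makes all exponents that occur nonnegative. With this
division, Hensel lifting produces the factorization in the completion. The error is filtered by a
positive weight `ω` orthogonal to `c`, and stays in the cone throughout
(`exists_mul_eq_of_division`).

The remaining point is that initial forms are independent of the expansion. A regular system of
parameters is analytically independent for every weight filtration; this follows from Krull's
height theorem applied to the elements `x i - t^(l i)` of `R[t]`
(`IsRegularSystemOfParameters.monomialsIndependent`), and it passes to the completion. There, finite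
expansions exist by completeness and Dickson's lemma (`exists_isExpansion`). Thus an element whose
terms of lowest weight are known has a known compact face and initial form
(`hasInitialFormAlong_of_sub_mem`).
-/

/-! ### Monomials and monomial ideals in a commutative ring -/

section Monomials

variable {S : Type*} [CommRing S] {n : ℕ}

/-- The monomial `x^A` in the elements `x`. -/
noncomputable def monomialAt (x : Fin n → S) (A : Fin n →₀ ℕ) : S :=
  MvPolynomial.eval x (MvPolynomial.monomial A 1)

theorem monomialAt_eq_prod (x : Fin n → S) (A : Fin n →₀ ℕ) :
    monomialAt x A = ∏ i, x i ^ A i := by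
  simp [monomialAt, MvPolynomial.eval_monomial, Finsupp.prod_fintype]

@[simp]
theorem monomialAt_zero (x : Fin n → S) : monomialAt x 0 = 1 := by
  simp [monomialAt_eq_prod]

theorem monomialAt_add (x : Fin n → S) (A B : Fin n →₀ ℕ) :
    monomialAt x (A + B) = monomialAt x A * monomialAt x B := by
  simp [monomialAt_eq_prod, pow_add, Finset.prod_mul_distrib]

@[simp]
theorem monomialAt_single (x : Fin n → S) (i : Fin n) :
    monomialAt x (Finsupp.single i 1) = x i := by
  simp [monomialAt, MvPolynomial.eval_monomial]

theorem map_monomialAt {T : Type*} [CommRing T] (φ : S →+* T) (x : Fin n → S)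
    (A : Fin n →₀ ℕ) : φ (monomialAt x A) = monomialAt (fun i => φ (x i)) A := by
  simp [monomialAt_eq_prod]

theorem eval_eq_sum_monomialAt (x : Fin n → S) (P : MvPolynomial (Fin n) S) :
    MvPolynomial.eval x P = ∑ A ∈ P.support, P.coeff A * monomialAt x A := by
  simp only [MvPolynomial.eval_eq', monomialAt_eq_prod]

theorem eval_monomial_eq (x : Fin n → S) (A : Fin n →₀ ℕ) (a : S) :
    MvPolynomial.eval x (MvPolynomial.monomial A a) = a * monomialAt x A := by
  simp [monomialAt, MvPolynomial.eval_monomial]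

/-- The ideal generated by the monomials in `x` with exponents in `U`. -/
def monomialIdeal (x : Fin n → S) (U : Set (Fin n →₀ ℕ)) : Ideal S :=
  Ideal.span (monomialAt x '' U)

theorem monomialAt_mem_monomialIdeal (x : Fin n → S) {U : Set (Fin n →₀ ℕ)} {A : Fin n →₀ ℕ}
    (hA : A ∈ U) : monomialAt x A ∈ monomialIdeal x U :=
  Ideal.subset_span ⟨A, hA, rfl⟩

theorem monomialIdeal_mono (x : Fin n → S) {U V : Set (Fin n →₀ ℕ)} (h : U ⊆ V) :
    monomialIdeal x U ≤ monomialIdeal x V :=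
  Ideal.span_mono (Set.image_mono h)

theorem monomialIdeal_mul_le (x : Fin n → S) (U V : Set (Fin n →₀ ℕ)) :
    monomialIdeal x U * monomialIdeal x V ≤ monomialIdeal x (U + V) := by
  rw [monomialIdeal, monomialIdeal, Ideal.span_mul_span', Ideal.span_le]
  rintro _ ⟨_, ⟨A, hA, rfl⟩, _, ⟨B, hB, rfl⟩, rfl⟩
  change monomialAt x A * monomialAt x B ∈ _
  rw [← monomialAt_add]
  exact monomialAt_mem_monomialIdeal x (Set.add_mem_add hA hB)

theorem map_monomialIdeal {T : Type*} [CommRing T] (φ : S →+* T) (x : Fin n → S)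
    (U : Set (Fin n →₀ ℕ)) :
    (monomialIdeal x U).map φ = monomialIdeal (fun i => φ (x i)) U := by
  rw [monomialIdeal, Ideal.map_span, Set.image_image]
  simp only [map_monomialAt]
  rfl

/-- The ideal generated by the monomials in `x` whose weight with respect to `l` is at least
`d`. -/
def weightIdeal (x : Fin n → S) (l : Fin n → ℕ) (d : ℕ) : Ideal S :=
  monomialIdeal x {A | d ≤ Finsupp.weight l A}

theorem weight_eq_sum_mul (l : Fin n → ℕ) (A : Fin n →₀ ℕ) :
    Finsupp.weight l A = ∑ i, l i * A i := by
  simp [Finsupp.weight_eq_sum, mul_comm]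

theorem monomialAt_mem_weightIdeal (x : Fin n → S) (l : Fin n → ℕ) {d : ℕ} {A : Fin n →₀ ℕ}
    (h : d ≤ Finsupp.weight l A) : monomialAt x A ∈ weightIdeal x l d :=
  monomialAt_mem_monomialIdeal x h

theorem weightIdeal_anti (x : Fin n → S) (l : Fin n → ℕ) {d d' : ℕ} (h : d ≤ d') :
    weightIdeal x l d' ≤ weightIdeal x l d :=
  monomialIdeal_mono x fun _ hA => le_trans h hA

theorem weightIdeal_mul_le (x : Fin n → S) (l : Fin n → ℕ) (d d' : ℕ) :
    weightIdeal x l d * weightIdeal x l d' ≤ weightIdeal x l (d + d') := by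
  refine (monomialIdeal_mul_le x _ _).trans (monomialIdeal_mono x ?_)
  rintro _ ⟨A, hA, B, hB, rfl⟩
  simpa using add_le_add hA hB

theorem span_range_le_weightIdeal (x : Fin n → S) {l : Fin n → ℕ} (hl : ∀ i, 0 < l i) :
    Ideal.span (Set.range x) ≤ weightIdeal x l 1 := by
  rw [Ideal.span_le]
  rintro _ ⟨i, rfl⟩
  rw [← monomialAt_single x i]
  exact monomialAt_mem_weightIdeal x l (by rw [Finsupp.weight_single]; simpa using! hl i)

theorem span_range_pow_le_weightIdeal (x : Fin n → S) {l : Fin n → ℕ} (hl : ∀ i, 0 < l i)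
    (N : ℕ) : Ideal.span (Set.range x) ^ N ≤ weightIdeal x l N := by
  induction N with
  | zero =>
    have : (1 : S) ∈ weightIdeal x l 0 := by
      rw [← monomialAt_zero x]
      exact monomialAt_mem_weightIdeal x l (Nat.zero_le _)
    rw [(Ideal.eq_top_iff_one _).2 this]
    exact le_top
  | succ N ih =>
    rw [pow_succ]
    exact (Ideal.mul_mono ih (span_range_le_weightIdeal x hl)).trans (weightIdeal_mul_le x l N 1)

theorem monomialAt_mem_span_pow (x : Fin n → S) (A : Fin n →₀ ℕ) :
    monomialAt x A ∈ Ideal.span (Set.range x) ^ A.degree := by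
  rw [monomialAt_eq_prod, Finsupp.degree_eq_sum, ← Finset.prod_pow_eq_pow_sum]
  exact Ideal.prod_mem_prod fun i _ =>
    Ideal.pow_mem_pow (Ideal.subset_span (Set.mem_range_self i)) _

theorem weightIdeal_le_span_range_pow (x : Fin n → S) {l : Fin n → ℕ} {W : ℕ} (hW : 0 < W)
    (hl : ∀ i, l i ≤ W) (N : ℕ) :
    weightIdeal x l (W * N) ≤ Ideal.span (Set.range x) ^ N := by
  rw [weightIdeal, monomialIdeal, Ideal.span_le]
  rintro _ ⟨A, hA, rfl⟩
  refine Ideal.pow_le_pow_right ?_ (monomialAt_mem_span_pow x A)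
  have h1 : Finsupp.weight l A ≤ W * A.degree := by
    rw [weight_eq_sum_mul, Finsupp.degree_eq_sum, Finset.mul_sum]
    exact Finset.sum_le_sum fun i _ => Nat.mul_le_mul_right _ (hl i)
  exact Nat.le_of_mul_le_mul_left (le_trans hA h1) hW

end Monomials

/-! ### Analytic independence of a regular system of parameters -/

section Independence

variable {S : Type*} [CommRing S] {n : ℕ}

/-- No monomial in `x` lies in the ideal generated by the monomials of larger weight, for any
positive weight. In a local ring with maximal ideal `(x)` this says that the graded rings of all
weight filtrations are polynomial rings in the classes of the `x i`. -/
def MonomialsIndependent (x : Fin n → S) : Prop :=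
  ∀ l : Fin n → ℕ, (∀ i, 0 < l i) → ∀ A : Fin n →₀ ℕ,
    monomialAt x A ∉ weightIdeal x l (Finsupp.weight l A + 1)

theorem monomialAt_pow (t : S) (l : Fin n → ℕ) (A : Fin n →₀ ℕ) :
    monomialAt (fun i => t ^ l i) A = t ^ Finsupp.weight l A := by
  simp [monomialAt_eq_prod, weight_eq_sum_mul, ← pow_mul, Finset.prod_pow_eq_pow_sum]

/-- If `x^A` were in the ideal generated by the monomials of larger weight, then the `n` elements
`x i - t^(l i)` of `R[t]` would have the prime `(m, t)`, of height `n + 1`, as a minimal prime: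
modulo them, `t^(l·A)` is a multiple of `t^(l·A+1)`. This contradicts Krull's height theorem. -/
theorem IsRegularSystemOfParameters.monomialsIndependent {R : Type*} [CommRing R] [IsLocalRing R]
    [IsNoetherianRing R] {x : Fin n → R} (hx : IsRegularSystemOfParameters x) :
    MonomialsIndependent x := by
  classical
  intro l hl A hmem
  let J : Ideal (Polynomial R) :=
    Ideal.span (Set.range fun i => Polynomial.C (x i) - Polynomial.X ^ l i)
  let P : Ideal (Polynomial R) := (maximalIdeal R).comap Polynomial.constantCoeff
  have hPmem (f : Polynomial R) : f ∈ P ↔ f.coeff 0 ∈ maximalIdeal R := Iff.rfl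
  have hXP : (Polynomial.X : Polynomial R) ∈ P := by simp [hPmem]
  have hJP : J ≤ P := by
    rw [Ideal.span_le]
    rintro _ ⟨i, rfl⟩
    refine P.sub_mem ?_ (P.pow_mem_of_mem hXP _ (hl i))
    rw [hPmem, Polynomial.coeff_C_zero, ← hx.span_eq]
    exact Ideal.subset_span ⟨i, rfl⟩
  let ψ := Ideal.Quotient.mk J
  have hψ (i : Fin n) : ψ (Polynomial.C (x i)) = ψ Polynomial.X ^ l i := by
    rw [← map_pow, Ideal.Quotient.eq]
    exact Ideal.subset_span ⟨i, rfl⟩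
  have hψm (B : Fin n →₀ ℕ) :
      ψ (Polynomial.C (monomialAt x B)) = ψ Polynomial.X ^ Finsupp.weight l B := by
    rw [map_monomialAt, map_monomialAt]
    simp only [hψ]
    exact monomialAt_pow _ _ _
  have hspan : ψ (Polynomial.C (monomialAt x A)) ∈
      Ideal.span {ψ Polynomial.X ^ (Finsupp.weight l A + 1)} := by
    have hle : weightIdeal x l (Finsupp.weight l A + 1) ≤
        (Ideal.span {ψ Polynomial.X ^ (Finsupp.weight l A + 1)}).comap
          (ψ.comp Polynomial.C) := by
      rw [weightIdeal, monomialIdeal, Ideal.span_le]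
      rintro _ ⟨B, hB, rfl⟩
      simp only [SetLike.mem_coe, Ideal.mem_comap, RingHom.comp_apply, hψm]
      exact Ideal.mem_span_singleton.2 (pow_dvd_pow _ hB)
    exact hle hmem
  rw [hψm, Ideal.mem_span_singleton] at hspan
  obtain ⟨v', hv⟩ := hspan
  obtain ⟨v, rfl⟩ := Ideal.Quotient.mk_surjective v'
  have hv' : Polynomial.X ^ Finsupp.weight l A * (1 - Polynomial.X * v) ∈ J := by
    rw [← Ideal.Quotient.eq_zero_iff_mem]
    change ψ _ = 0
    have : ψ Polynomial.X ^ Finsupp.weight l A =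
      ψ Polynomial.X ^ (Finsupp.weight l A + 1) * ψ v := hv
    simp only [map_mul, map_sub, map_one, map_pow]
    linear_combination this
  have hmin : P ∈ J.minimalPrimes := by
    refine ⟨⟨inferInstance, hJP⟩, ?_⟩
    rintro Q ⟨hQ, hJQ⟩ hQP
    have hXQ : (Polynomial.X : Polynomial R) ∈ Q := by
      rcases hQ.mem_or_mem (hJQ hv') with h | h
      · exact hQ.mem_of_pow_mem _ h
      · have := (hPmem _).1 (hQP h)
        simp at this
    have hCQ : (maximalIdeal R).map Polynomial.C ≤ Q := by
      rw [← hx.span_eq, Ideal.map_span, Ideal.span_le]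
      rintro _ ⟨_, ⟨i, rfl⟩, rfl⟩
      have h1 : Polynomial.C (x i) - Polynomial.X ^ l i ∈ Q := hJQ (Ideal.subset_span ⟨i, rfl⟩)
      have h2 := Q.add_mem h1 (Q.pow_mem_of_mem hXQ _ (hl i))
      simpa using h2
    intro f hf
    rw [← Polynomial.divX_mul_X_add f]
    exact Q.add_mem (Q.mul_mem_left _ hXQ) (hCQ (Ideal.mem_map_of_mem _ ((hPmem f).1 hf)))
  have hupper : P.height ≤ n := by
    refine (Ideal.height_le_card_of_mem_minimalPrimes_span (Set.finite_range _) hmin).trans ?_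
    rw [← Set.image_univ]
    have := Set.ncard_image_le (f := fun i => Polynomial.C (x i) - Polynomial.X ^ l i)
      (Set.finite_univ (α := Fin n))
    rw [Set.ncard_univ, Nat.card_fin] at this
    exact_mod_cast this
  have hlower : (n : ℕ∞) + 1 ≤ P.height := by
    have hm : (maximalIdeal R).height = n := by
      have := maximalIdeal_height_eq_ringKrullDim (R := R)
      rw [hx.dim_eq] at this
      exact_mod_cast this
    have hprime : ((maximalIdeal R).map Polynomial.C).IsPrime := 
      Ideal.isPrime_map_C_of_isPrime
    have hlt : (maximalIdeal R).map Polynomial.C < P := by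
      refine lt_of_le_of_ne ?_ ?_
      · rw [Ideal.map_le_iff_le_comap]
        intro a ha
        simpa [hPmem] using ha
      · intro h
        have : (Polynomial.X : Polynomial R) ∈ (maximalIdeal R).map Polynomial.C := h ▸ hXP
        rw [Ideal.mem_map_C_iff] at this
        have := this 1
        simp at this
    have := Ideal.height_add_one_le_of_lt_of_isPrime hlt
    rwa [Polynomial.height_map_C, hm] at this
  have := hlower.trans hupper
  exact absurd this (by norm_cast; omega)

/-- Membership in a weight ideal can be tested modulo a high power of `(x)`, which the weight ideal
contains. -/
theorem MonomialsIndependent.adicCompletion {R : Type*} [CommRing R]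
    {x : Fin n → R} (hx : MonomialsIndependent x) :
    MonomialsIndependent
      (fun i => algebraMap R (AdicCompletion (Ideal.span (Set.range x)) R) (x i)) := by
  intro l hl A hmem
  set I := Ideal.span (Set.range x)
  set d := Finsupp.weight l A
  let ev := AdicCompletion.evalₐ I (d + 1)
  have hev (a : R) : ev (algebraMap R (AdicCompletion I R) a) = Ideal.Quotient.mk _ a :=
    ev.commutes a
  refine hx l hl A ?_
  have h1 := Ideal.mem_map_of_mem ev.toRingHom hmem
  rw [weightIdeal, map_monomialIdeal, map_monomialAt] at h1
  have h2 : (fun i => ev.toRingHom (algebraMap R (AdicCompletion I R) (x i))) =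
      fun i => Ideal.Quotient.mk (I ^ (d + 1)) (x i) := funext fun i => hev (x i)
  rw [h2, ← map_monomialAt, ← map_monomialIdeal] at h1
  have h3 := (Ideal.mem_map_iff_of_surjective _ Ideal.Quotient.mk_surjective).1 h1
  obtain ⟨y, hy, hyA⟩ := h3
  rw [Ideal.Quotient.eq] at hyA
  have h4 := span_range_pow_le_weightIdeal x hl _ hyA
  have := Ideal.sub_mem _ hy h4
  simpa using! this

/-- Weights separate the exponents of bounded degree: read an exponent as the digits of a number. -/
theorem exists_weight_injOn (n d : ℕ) : ∃ e : Fin n → ℕ,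
    Set.InjOn (Finsupp.weight e : (Fin n →₀ ℕ) →+ ℕ) {A | ∀ i, A i ≤ d} := by
  refine ⟨fun i => (d + 1) ^ (i : ℕ), fun A hA B hB h => ?_⟩
  have key (C : Fin n →₀ ℕ) : Finsupp.weight (fun i : Fin n => (d + 1) ^ (i : ℕ)) C =
      Nat.ofDigits (d + 1) (List.ofFn C) := by
    rw [Nat.ofDigits_eq_sum_mapIdx, weight_eq_sum_mul, List.mapIdx_eq_ofFn, List.sum_ofFn]
    refine Fintype.sum_equiv (finCongr (by simp)) _ _ fun i => ?_
    simp [mul_comm]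
  rw [key, key] at h
  rcases Nat.eq_zero_or_pos d with rfl | hd
  · ext i
    have h1 := hA i
    have h2 := hB i
    omega
  · have := Nat.ofDigits_inj_of_len_eq (by omega) (by simp)
      (fun a ha => by
        obtain ⟨i, rfl⟩ := (List.mem_ofFn' _ _).1 ha
        exact Nat.lt_succ_of_le (hA i))
      (fun a ha => by
        obtain ⟨i, rfl⟩ := (List.mem_ofFn' _ _).1 ha
        exact Nat.lt_succ_of_le (hB i)) h
    exact DFunLike.coe_injective (List.ofFn_injective this)

/-- The coefficients of lowest weight of a polynomial lie in the maximal ideal if its value has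
larger weight. A weight that separates the exponents of weight `d` reduces this to a single
monomial. -/
theorem MonomialsIndependent.coeff_mem_maximalIdeal [IsLocalRing S] {x : Fin n → S}
    (hx : MonomialsIndependent x) (hspan : Ideal.span (Set.range x) = maximalIdeal S)
    {l : Fin n → ℕ} (hl : ∀ i, 0 < l i) {P : MvPolynomial (Fin n) S} {d : ℕ}
    (hP : ∀ A ∈ P.support, d ≤ Finsupp.weight l A)
    (heval : MvPolynomial.eval x P ∈ weightIdeal x l (d + 1)) {A : Fin n →₀ ℕ}
    (hA : Finsupp.weight l A = d) : P.coeff A ∈ maximalIdeal S := by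
  classical
  by_contra hunit
  obtain ⟨e, he⟩ := exists_weight_injOn n d
  let T := P.support.filter fun A => Finsupp.weight l A = d ∧ P.coeff A ∉ maximalIdeal S
  have hT : T.Nonempty := by
    refine ⟨A, Finset.mem_filter.2 ⟨?_, hA, hunit⟩⟩
    rw [MvPolynomial.mem_support_iff]
    rintro h
    exact hunit (h ▸ zero_mem _)
  obtain ⟨A, hAT, hmin⟩ := T.exists_min_image (Finsupp.weight e) hT
  obtain ⟨hAP, hA, hunit⟩ := Finset.mem_filter.1 hAT
  have hbound {B : Fin n →₀ ℕ} (hB : Finsupp.weight l B = d) (i : Fin n) : B i ≤ d :=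
    hB ▸ Finsupp.le_weight l (hl i).ne' B
  let M := Finsupp.weight e A + 1
  let l' : Fin n → ℕ := fun i => M * l i + e i
  have hl' (B : Fin n →₀ ℕ) :
      Finsupp.weight l' B = M * Finsupp.weight l B + Finsupp.weight e B := by
    simp only [weight_eq_sum_mul, l', add_mul, Finset.sum_add_distrib, Finset.mul_sum, mul_assoc]
  have hbig : weightIdeal x l (d + 1) ≤ weightIdeal x l' (Finsupp.weight l' A + 1) := by
    refine monomialIdeal_mono x fun B hB => ?_
    change Finsupp.weight l' A + 1 ≤ Finsupp.weight l' B
    rw [hl', hl', hA]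
    have h1 : M * (d + 1) ≤ M * Finsupp.weight l B := Nat.mul_le_mul_left _ hB
    have h2 : M * (d + 1) = M * d + (Finsupp.weight e A + 1) := by rw [mul_add, mul_one]
    omega
  refine hx l' (fun i => Nat.add_pos_left (Nat.mul_pos (Nat.succ_pos _) (hl i)) _) A ?_
  have hsum := eval_eq_sum_monomialAt x P
  rw [← Finset.add_sum_erase _ _ hAP] at hsum
  have hrest : ∑ B ∈ P.support.erase A, P.coeff B * monomialAt x B ∈
      weightIdeal x l' (Finsupp.weight l' A + 1) := by
    refine Ideal.sum_mem _ fun B hB => ?_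
    obtain ⟨hBA, hBP⟩ := Finset.mem_erase.1 hB
    rcases (hP B hBP).eq_or_lt with hBd | hBd
    · by_cases hBu : P.coeff B ∈ maximalIdeal S
      · rw [← hspan] at hBu
        refine hbig ?_
        have := Ideal.mul_mem_mul (span_range_le_weightIdeal x hl hBu)
          (monomialAt_mem_weightIdeal x l (le_refl (Finsupp.weight l B)))
        refine weightIdeal_anti x l ?_ (weightIdeal_mul_le x l _ _ this)
        omega
      · refine Ideal.mul_mem_left _ _ (monomialAt_mem_weightIdeal x l' ?_)
        have h1 := hmin B (Finset.mem_filter.2 ⟨hBP, hBd.symm, hBu⟩)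
        have h2 : Finsupp.weight e A ≠ Finsupp.weight e B := fun h =>
          hBA (he (hbound hA) (hbound hBd.symm) h).symm
        rw [hl', hl', hA, ← hBd]
        omega
    · exact hbig (Ideal.mul_mem_left _ _ (monomialAt_mem_weightIdeal x l hBd))
  have hmem : P.coeff A * monomialAt x A ∈ weightIdeal x l' (Finsupp.weight l' A + 1) := by
    have := Ideal.sub_mem _ (hbig heval) hrest
    rwa [hsum, add_sub_cancel_right] at this
  have hu : IsUnit (P.coeff A) := by simpa using hunit
  exact (Ideal.unit_mul_mem_iff_mem _ hu).1 hmem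

end Independence

/-! ### Finite expansions in a complete local ring -/

section Expansion

variable {S : Type*} [CommRing S] {n : ℕ}

theorem exists_adic_limit {I : Ideal S} [IsAdicComplete I S] (a : ℕ → S)
    (ha : ∀ k, a (k + 1) - a k ∈ I ^ k) : ∃ L, ∀ k, L - a k ∈ I ^ k := by
  have hle {m k : ℕ} (h : m ≤ k) : a k - a m ∈ I ^ m := by
    induction k, h using Nat.le_induction with
    | base => simp
    | succ k hmk ih =>
      have := Ideal.add_mem _ (Ideal.pow_le_pow_right hmk (ha k)) ih
      rwa [sub_add_sub_cancel] at this
  obtain ⟨L, hL⟩ := IsPrecomplete.prec (I := I) (M := S) inferInstance (f := a) fun {m k} h => by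
    rw [SModEq.sub_mem, smul_eq_mul, Ideal.mul_top, ← neg_mem_iff, neg_sub]
    exact hle h
  refine ⟨L, fun k => ?_⟩
  have := hL k
  rwa [SModEq.sub_mem, smul_eq_mul, Ideal.mul_top, ← neg_mem_iff, neg_sub] at this

theorem eq_zero_of_forall_mem_pow {I : Ideal S} [IsHausdorff I S] {a : S}
    (ha : ∀ k, a ∈ I ^ k) : a = 0 :=
  IsHausdorff.haus (I := I) inferInstance a fun k => by
    rw [SModEq.zero, smul_eq_mul, Ideal.mul_top]
    exact ha k

/-- An element of `m^N` is, modulo `m^(N+1)`, a form of degree `N` in generators of `m` whose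
coefficients are units or zero. -/
theorem exists_form_sub_mem [IsLocalRing S] {x : Fin n → S}
    (hspan : Ideal.span (Set.range x) = maximalIdeal S) (N : ℕ) {r : S}
    (hr : r ∈ maximalIdeal S ^ N) :
    ∃ p : MvPolynomial (Fin n) S, (∀ A ∈ p.support, A.degree = N) ∧
      (∀ A ∈ p.support, IsUnit (p.coeff A)) ∧
      r - MvPolynomial.eval x p ∈ maximalIdeal S ^ (N + 1) := by
  classical
  rw [← hspan, Ideal.mem_span_pow_iff_exists_isHomogeneous] at hr
  obtain ⟨q, hq, rfl⟩ := hr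
  have hdeg {A : Fin n →₀ ℕ} (hA : A ∈ q.support) : A.degree = N := by
    have := hq (MvPolynomial.mem_support_iff.1 hA)
    rw [Finsupp.degree_eq_weight_one]
    exact this
  let p := ∑ A ∈ q.support with IsUnit (q.coeff A), MvPolynomial.monomial A (q.coeff A)
  have hp (A : Fin n →₀ ℕ) : p.coeff A = if IsUnit (q.coeff A) then q.coeff A else 0 := by
    simp only [p, MvPolynomial.coeff_sum, MvPolynomial.coeff_monomial, Finset.sum_ite_eq',
      Finset.mem_filter, MvPolynomial.mem_support_iff]
    by_cases h : q.coeff A = 0 <;> simp [h]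
  have hpu {A : Fin n →₀ ℕ} (hA : A ∈ p.support) : IsUnit (q.coeff A) := by
    by_contra h
    rw [MvPolynomial.mem_support_iff, hp, if_neg h] at hA
    exact hA rfl
  refine ⟨p, fun A hA => hdeg ?_, fun A hA => ?_, ?_⟩
  · rw [MvPolynomial.mem_support_iff]
    exact (hpu hA).ne_zero
  · rw [hp, if_pos (hpu hA)]
    exact hpu hA
  · rw [← map_sub, eval_eq_sum_monomialAt]
    refine Ideal.sum_mem _ fun A hA => ?_
    have hcoeff : (q - p).coeff A ∈ maximalIdeal S := by
      rw [MvPolynomial.coeff_sub, hp]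
      split_ifs with h
      · simp
      · simpa using h
    have hAq : A ∈ q.support := by
      rw [MvPolynomial.mem_support_iff] at hA ⊢
      intro h
      apply hA
      rw [MvPolynomial.coeff_sub, hp, h]
      simp
    rw [pow_succ']
    refine Ideal.mul_mem_mul hcoeff ?_
    rw [← hdeg hAq, ← hspan]
    exact monomialAt_mem_span_pow x A

/-- The terms of an infinite expansion are grouped according to the finitely many minimal
exponents, which exist by Dickson's lemma. -/
theorem exists_isExpansion [IsLocalRing S] [IsAdicComplete (maximalIdeal S) S] {x : Fin n → S}
    (hspan : Ideal.span (Set.range x) = maximalIdeal S) (f : S) :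
    ∃ ρ : MvPolynomial (Fin n) S, IsExpansion x f ρ := by
  classical
  let m := maximalIdeal S
  choose! p' hdeg' hunit' hmem' using fun N (r : S) (hr : r ∈ m ^ N) =>
    exists_form_sub_mem hspan N hr
  let r : ℕ → S := fun N => Nat.rec f (fun N r => r - MvPolynomial.eval x (p' N r)) N
  have hr (N : ℕ) : r N ∈ m ^ N := by
    induction N with
    | zero => simp
    | succ N ih => exact hmem' N _ ih
  let p : ℕ → MvPolynomial (Fin n) S := fun N => p' N (r N)
  have hdeg (N : ℕ) : ∀ A ∈ (p N).support, A.degree = N := hdeg' N _ (hr N)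
  have hunit (N : ℕ) : ∀ A ∈ (p N).support, IsUnit ((p N).coeff A) := hunit' N _ (hr N)
  have hsum (N : ℕ) : f - ∑ k ∈ Finset.range N, MvPolynomial.eval x (p k) = r N := by
    induction N with
    | zero => simp [r]
    | succ N ih =>
      rw [Finset.sum_range_succ, ← sub_sub, ih]
  let Sig : (Fin n →₀ ℕ) → Prop := fun A => A ∈ (p A.degree).support
  have hSig {k : ℕ} {A : Fin n →₀ ℕ} (hA : A ∈ (p k).support) : Sig A := by
    have := hdeg k A hA
    simpa only [Sig, this] using hA
  have hfin : {A | Minimal Sig A}.Finite :=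
    WellQuasiOrderedLE.finite_of_isAntichain (setOfPred_minimal_antichain Sig)
  let V := hfin.toFinset
  have hV {A : Fin n →₀ ℕ} : A ∈ V ↔ Minimal Sig A := by simp [V]
  choose! ι hιle hιmin using fun A (hA : Sig A) => exists_minimal_le_of_wellFoundedLT Sig A hA
  -- the part of the form of degree `k` that is assigned to `B`, divided by `x^B`
  let s : (Fin n →₀ ℕ) → ℕ → S := fun B k =>
    ∑ A ∈ (p k).support with ι A = B, (p k).coeff A * monomialAt x (A - B)
  have hs (k : ℕ) : MvPolynomial.eval x (p k) = ∑ B ∈ V, s B k * monomialAt x B := by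
    rw [eval_eq_sum_monomialAt,
      ← Finset.sum_fiberwise_of_maps_to (t := V) (g := ι) fun A hA => hV.2 (hιmin A (hSig hA))]
    refine Finset.sum_congr rfl fun B _ => ?_
    rw [Finset.sum_mul]
    refine Finset.sum_congr rfl fun A hA => ?_
    obtain ⟨hAk, rfl⟩ := Finset.mem_filter.1 hA
    rw [mul_assoc, ← monomialAt_add, tsub_add_cancel_of_le (hιle A (hSig hAk))]
  have hsmem (B : Fin n →₀ ℕ) (k : ℕ) : s B k ∈ m ^ (k - B.degree) := by
    refine Ideal.sum_mem _ fun A hA => Ideal.mul_mem_left _ _ ?_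
    obtain ⟨hAk, rfl⟩ := Finset.mem_filter.1 hA
    have h1 := congrArg Finsupp.degree (tsub_add_cancel_of_le (hιle A (hSig hAk)))
    rw [map_add, hdeg k A hAk] at h1
    have := monomialAt_mem_span_pow x (A - ι A)
    rw [hspan] at this
    rwa [← h1, Nat.add_sub_cancel]
  have hlim (B : Fin n →₀ ℕ) : ∃ L, ∀ k,
      L - ∑ j ∈ Finset.range (k + B.degree), s B j ∈ m ^ k := by
    refine exists_adic_limit _ fun k => ?_
    rw [add_right_comm, Finset.sum_range_succ, add_sub_cancel_left]
    simpa using hsmem B (k + B.degree)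
  choose c hc using hlim
  have hcunit {B : Fin n →₀ ℕ} (hB : B ∈ V) : IsUnit (c B) := by
    have hBmin := hV.1 hB
    have h1 := hc B 1
    have h2 : ∑ j ∈ Finset.range (1 + B.degree), s B j = (p B.degree).coeff B := by
      have hA {j : ℕ} (hj : j < 1 + B.degree) {A : Fin n →₀ ℕ} (hA : A ∈ (p j).support)
          (hAB : ι A = B) : A = B := by
        have hle := hιle A (hSig hA)
        rw [hAB] at hle
        obtain ⟨D, rfl⟩ := exists_add_of_le hle
        have := hdeg j _ hA
        rw [map_add] at this
        have hD : D = 0 := (Finsupp.degree_eq_zero_iff D).1 (by omega)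
        simp [hD]
      have hιB : ι B = B :=
        hBmin.eq_of_le (hιmin B hBmin.prop).prop (hιle B hBmin.prop)
      rw [Finset.sum_eq_single B.degree]
      · have hfilter : {A ∈ (p B.degree).support | ι A = B} = {B} := by
          ext A
          rw [Finset.mem_filter, Finset.mem_singleton]
          constructor
          · rintro ⟨h2, h3⟩
            exact hA (by omega) h2 h3
          · rintro rfl
            exact ⟨hBmin.prop, hιB⟩
        simp [s, hfilter]
      · intro j hj hne
        refine Finset.sum_eq_zero fun A hA' => ?_
        obtain ⟨h2, h3⟩ := Finset.mem_filter.1 hA'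
        have h4 := hA (Finset.mem_range.1 hj) h2 h3
        exact absurd (h4 ▸ hdeg j _ h2).symm hne
      · intro h
        simp at h
    rw [h2, pow_one] at h1
    have hu := hunit _ _ hBmin.prop
    by_contra hcu
    have h3 : c B ∈ m := hcu
    have h4 := Ideal.sub_mem _ h3 h1
    rw [sub_sub_cancel] at h4
    exact h4 hu
  have hf : f = ∑ B ∈ V, c B * monomialAt x B := by
    rw [← sub_eq_zero]
    refine eq_zero_of_forall_mem_pow (I := m) fun k => ?_
    obtain ⟨D, hD⟩ : ∃ D, ∀ B ∈ V, B.degree ≤ D :=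
      ⟨V.sup Finsupp.degree, fun B hB => Finset.le_sup (f := Finsupp.degree) hB⟩
    have h1 : f - ∑ j ∈ Finset.range (k + D), MvPolynomial.eval x (p j) ∈ m ^ k := by
      rw [hsum]
      exact Ideal.pow_le_pow_right (Nat.le_add_right _ _) (hr _)
    have h2 : ∑ B ∈ V, (c B - ∑ j ∈ Finset.range (k + D), s B j) * monomialAt x B ∈ m ^ k := by
      refine Ideal.sum_mem _ fun B hB => Ideal.mul_mem_right _ _ ?_
      have h3 := hc B (k + D - B.degree)
      have h4 := hD B hB
      rw [Nat.sub_add_cancel (by omega)] at h3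
      exact Ideal.pow_le_pow_right (by omega) h3
    have h3 : ∑ j ∈ Finset.range (k + D), MvPolynomial.eval x (p j) =
        ∑ B ∈ V, (∑ j ∈ Finset.range (k + D), s B j) * monomialAt x B := by
      simp only [hs, Finset.sum_mul]
      exact Finset.sum_comm
    have h4 := Ideal.sub_mem _ h1 h2
    simp only [sub_mul, Finset.sum_sub_distrib] at h4
    rw [h3] at h4
    convert h4 using 1
    ring
  refine ⟨∑ B ∈ V, MvPolynomial.monomial B (c B), fun A hA => ?_, ?_⟩
  · have hcoeff : (∑ B ∈ V, MvPolynomial.monomial B (c B)).coeff A = if A ∈ V then c A else 0 := by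
      simp [MvPolynomial.coeff_sum, MvPolynomial.coeff_monomial]
    rw [MvPolynomial.mem_support_iff, hcoeff] at hA
    rw [hcoeff]
    split_ifs at hA ⊢ with h
    · exact hcunit h
    · exact absurd rfl hA
  · simp only [map_sum, eval_monomial_eq]
    exact hf.symm

end Expansion

/-! ### Compact faces of Newton polyhedra and initial forms -/

section Faces

variable {n : ℕ}

theorem linForm_add (l v w : Fin n → ℝ) : linForm l (v + w) = linForm l v + linForm l w := by
  simp [linForm, mul_add, Finset.sum_add_distrib]

theorem linForm_smul (l : Fin n → ℝ) (a : ℝ) (v : Fin n → ℝ) :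
    linForm l (a • v) = a * linForm l v := by
  simp only [linForm, Pi.smul_apply, smul_eq_mul, Finset.mul_sum]
  exact Finset.sum_congr rfl fun i _ => by ring

theorem isLinearMap_linForm (l : Fin n → ℝ) : IsLinearMap ℝ (linForm l) :=
  ⟨linForm_add l, linForm_smul l⟩

theorem linForm_natCast (w : Fin n → ℕ) (A : Fin n →₀ ℕ) :
    linForm (fun i => (w i : ℝ)) (exponentPoint A) = (Finsupp.weight w A : ℕ) := by
  simp [linForm, exponentPoint, weight_eq_sum_mul]

/-- The exponents of `ρ` at which a linear form is minimal on the exponents of `ρ`. -/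
def minimalExponents {R : Type*} [CommRing R] (ρ : MvPolynomial (Fin n) R) (l : Fin n → ℝ) :
    Set (Fin n →₀ ℕ) :=
  {A | A ∈ ρ.support ∧
    ∀ B ∈ ρ.support, linForm l (exponentPoint A) ≤ linForm l (exponentPoint B)}

theorem newtonPolyhedron_eq {R : Type*} [CommRing R] (ρ : MvPolynomial (Fin n) R) :
    newtonPolyhedron ρ =
      convexHull ℝ (exponentPoint '' (ρ.support : Set (Fin n →₀ ℕ))) + {v | ∀ i, 0 ≤ v i} := by
  have horth : {v : Fin n → ℝ | ∀ i, 0 ≤ v i} = Set.Ici 0 := by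
    ext v
    simp [Pi.le_def]
  have hfin : (exponentPoint '' (ρ.support : Set (Fin n →₀ ℕ))).Finite :=
    ρ.support.finite_toSet.image _
  apply Set.Subset.antisymm
  · refine closedConvexHull_min (Set.add_subset_add_right (subset_convexHull ℝ _)) ?_ ?_
    · rw [horth]
      exact (convex_convexHull ℝ _).add (convex_Ici 0)
    · rw [horth]
      exact isClosed_Ici.add_left_of_isCompact (hfin.isCompact_convexHull ℝ)
  · rw [horth]
    have h : convexHull ℝ (exponentPoint '' (ρ.support : Set (Fin n →₀ ℕ))) + Set.Ici 0 =
        convexHull ℝ (exponentPoint '' (ρ.support : Set (Fin n →₀ ℕ)) +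
          (Set.Ici 0 : Set (Fin n → ℝ))) := by
      rw [convexHull_add, (convex_Ici (0 : Fin n → ℝ)).convexHull_eq]
    rw [h, newtonPolyhedron, horth]
    exact convexHull_subset_closedConvexHull

theorem faceOf_newtonPolyhedron {R : Type*} [CommRing R] {ρ : MvPolynomial (Fin n) R}
    (hρ : ρ.support.Nonempty) {l : Fin n → ℝ} (hl : ∀ i, 0 < l i) :
    faceOf (newtonPolyhedron ρ) l = convexHull ℝ (exponentPoint '' minimalExponents ρ l) := by
  obtain ⟨A, hA, hAmin⟩ :=
    ρ.support.exists_min_image (fun A => linForm l (exponentPoint A)) hρ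
  set μ := linForm l (exponentPoint A)
  have hlin := isLinearMap_linForm l
  apply Set.Subset.antisymm
  · rintro v ⟨hv, hvmin⟩
    have hvμ : linForm l v ≤ μ := hvmin _ (exponentPoint_mem_newtonPolyhedron hA)
    rw [newtonPolyhedron_eq] at hv
    obtain ⟨p, hp, u, hu, rfl⟩ := hv
    have hpμ : linForm l p = μ → p ∈ convexHull ℝ (exponentPoint '' minimalExponents ρ l) := by
      have hconst : ∀ q ∈ convexHull ℝ (exponentPoint '' minimalExponents ρ l),
          linForm l q = μ := by
        intro q hq
        refine convexHull_min (t := {q | linForm l q = μ}) ?_ (convex_hyperplane hlin μ) hq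
        rintro _ ⟨B, hB, rfl⟩
        exact le_antisymm (hB.2 A hA) (hAmin B hB.1)
      have hconv : Convex ℝ {q | q ∈ convexHull ℝ (exponentPoint '' minimalExponents ρ l) ∨
          μ < linForm l q} := by
        have hle : ∀ q, q ∈ convexHull ℝ (exponentPoint '' minimalExponents ρ l) ∨
            μ < linForm l q → μ ≤ linForm l q := by
          rintro q (hq | hq)
          · exact (hconst q hq).ge
          · exact hq.le
        rw [convex_iff_forall_pos]
        intro q hq q' hq' a b ha hb hab
        simp only [Set.mem_ofPred_eq] at hq hq' ⊢
        by_cases hboth : q ∈ convexHull ℝ (exponentPoint '' minimalExponents ρ l) ∧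
            q' ∈ convexHull ℝ (exponentPoint '' minimalExponents ρ l)
        · exact Or.inl (convex_convexHull ℝ _ hboth.1 hboth.2 ha.le hb.le hab)
        · right
          rw [linForm_add, linForm_smul, linForm_smul]
          have h1 := hle q hq
          have h2 := hle q' hq'
          have hμ : μ = a * μ + b * μ := by rw [← add_mul, hab, one_mul]
          rcases not_and_or.1 hboth with h | h
          · have h3 := hq.resolve_left h
            nlinarith
          · have h3 := hq'.resolve_left h
            nlinarith
      intro hpμ
      have hmem := convexHull_min (s := exponentPoint '' (ρ.support : Set (Fin n →₀ ℕ))) ?_ hconv hp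
      · exact hmem.resolve_right hpμ.not_gt
      · rintro _ ⟨B, hB, rfl⟩
        by_cases h : μ < linForm l (exponentPoint B)
        · exact Or.inr h
        · exact Or.inl (subset_convexHull ℝ _
            ⟨B, ⟨hB, fun C hC => (not_lt.1 h).trans (hAmin C hC)⟩, rfl⟩)
    have hpge : μ ≤ linForm l p := by
      refine convexHull_min (t := {q | μ ≤ linForm l q}) ?_ (convex_halfSpace_ge hlin μ) hp
      rintro _ ⟨B, hB, rfl⟩
      exact hAmin B hB
    rw [linForm_add] at hvμ
    have hterm : ∀ i ∈ Finset.univ, 0 ≤ l i * u i := fun i _ => mul_nonneg (hl i).le (hu i)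
    have hu0 : linForm l u = 0 :=
      le_antisymm (by linarith) (Finset.sum_nonneg hterm)
    have hu' : u = 0 := by
      ext i
      have := (Finset.sum_eq_zero_iff_of_nonneg hterm).1 hu0 i (Finset.mem_univ i)
      exact (mul_eq_zero.1 this).resolve_left (hl i).ne'
    subst hu'
    change p + 0 ∈ _
    rw [add_zero]
    exact hpμ (le_antisymm (by linarith) hpge)
  · have hconv : Convex ℝ (faceOf (newtonPolyhedron ρ) l) := by
      have hNP : Convex ℝ (newtonPolyhedron ρ) := convex_closedConvexHull
      intro v hv w hw a b ha hb hab
      refine ⟨hNP hv.1 hw.1 ha hb hab, fun z hz => ?_⟩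
      rw [linForm_add, linForm_smul, linForm_smul]
      have h1 := mul_le_mul_of_nonneg_left (hv.2 z hz) ha
      have h2 := mul_le_mul_of_nonneg_left (hw.2 z hz) hb
      have h3 : a * linForm l z + b * linForm l z = linForm l z := by rw [← add_mul, hab, one_mul]
      linarith
    refine convexHull_min ?_ hconv
    rintro _ ⟨B, hB, rfl⟩
    exact (exponentPoint_mem_faceOf_iff hB.1 hl).2 hB.2

theorem exponentPoint_injective : Function.Injective (exponentPoint (n := n)) := by
  intro A B h
  ext i
  have := congrFun h i
  simpa [exponentPoint] using this

/-- An element which agrees with the value of an `l`-homogeneous polynomial `P` with unit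
coefficients, up to monomials of larger weight, has along the face cut out by `l` the initial form
given by the residue classes of the coefficients of `P`. -/
theorem hasInitialFormAlong_of_sub_mem {S : Type*} [CommRing S] [IsLocalRing S]
    [IsAdicComplete (maximalIdeal S) S] {x : Fin n → S} (hx : MonomialsIndependent x)
    (hspan : Ideal.span (Set.range x) = maximalIdeal S) {l : Fin n → ℕ} (hl : ∀ i, 0 < l i)
    {P : MvPolynomial (Fin n) S} {e : ℕ} (hP : P ≠ 0)
    (hunit : ∀ A ∈ P.support, IsUnit (P.coeff A))
    (hweight : ∀ A ∈ P.support, Finsupp.weight l A = e) {g : S}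
    (hg : g - MvPolynomial.eval x P ∈ weightIdeal x l (e + 1)) :
    HasInitialFormAlong x g
      (convexHull ℝ (exponentPoint '' (P.support : Set (Fin n →₀ ℕ))))
      (MvPolynomial.map (residue S) P) := by
  classical
  refine ⟨exists_isExpansion hspan g, fun ρ hρ => ?_⟩
  have heval : MvPolynomial.eval x (ρ - P) ∈ weightIdeal x l (e + 1) := by
    rwa [map_sub, hρ.eval_eq]
  have hres {A : Fin n →₀ ℕ} (hA : A ∈ ρ.support) : ρ.coeff A ∉ maximalIdeal S := fun h =>
    h (hρ.isUnit_coeff A hA)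
  have hsupp {A : Fin n →₀ ℕ} (hA : A ∈ (ρ - P).support) : A ∈ ρ.support ∨ A ∈ P.support := by
    simpa using MvPolynomial.support_sub _ _ _ hA
  have hge : ∀ A ∈ ρ.support, e ≤ Finsupp.weight l A := by
    by_contra! hcon
    obtain ⟨A₀, hA₀, hlt₀⟩ := hcon
    obtain ⟨A, hA, hAmin⟩ := ρ.support.exists_min_image (Finsupp.weight l) ⟨A₀, hA₀⟩
    have hlt : Finsupp.weight l A < e := (hAmin A₀ hA₀).trans_lt hlt₀
    have hmem := hx.coeff_mem_maximalIdeal hspan hl (P := ρ - P) (d := Finsupp.weight l A)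
      (fun B hB => (hsupp hB).elim (hAmin B) fun h => (hweight B h).symm ▸ hlt.le)
      (weightIdeal_anti x l (by omega) heval) rfl
    have hPA : P.coeff A = 0 := by
      by_contra h
      have := hweight A (MvPolynomial.mem_support_iff.2 h)
      omega
    rw [MvPolynomial.coeff_sub, hPA, sub_zero] at hmem
    exact hres hA hmem
  have hcoeff {A : Fin n →₀ ℕ} (hA : Finsupp.weight l A = e) :
      residue S (ρ.coeff A) = residue S (P.coeff A) := by
    rw [← sub_eq_zero, ← map_sub, ← MvPolynomial.coeff_sub, residue_eq_zero_iff]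
    exact hx.coeff_mem_maximalIdeal hspan hl
      (fun B hB => (hsupp hB).elim (hge B) fun h => (hweight B h).ge) heval hA
  have hzero {A : Fin n →₀ ℕ} {Q : MvPolynomial (Fin n) S}
      (hQ : ∀ A ∈ Q.support, IsUnit (Q.coeff A)) : A ∈ Q.support ↔ residue S (Q.coeff A) ≠ 0 := by
    rw [ne_eq, residue_eq_zero_iff]
    refine ⟨fun h h' => h' (hQ A h), fun h => ?_⟩
    rw [MvPolynomial.mem_support_iff]
    rintro h0
    exact h (h0 ▸ zero_mem _)
  have hPsupp {A : Fin n →₀ ℕ} : A ∈ P.support ↔ A ∈ ρ.support ∧ Finsupp.weight l A = e := by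
    constructor
    · intro h
      have hw := hweight A h
      exact ⟨(hzero hρ.isUnit_coeff).2 (hcoeff hw ▸ (hzero hunit).1 h), hw⟩
    · rintro ⟨h, hw⟩
      exact (hzero hunit).2 (hcoeff hw ▸ (hzero hρ.isUnit_coeff).1 h)
  obtain ⟨A₀, hA₀⟩ := MvPolynomial.support_nonempty.2 hP
  have hA₀' := hPsupp.1 hA₀
  have hl' : ∀ i, (0 : ℝ) < (l i : ℝ) := fun i => by exact_mod_cast hl i
  have hmin : minimalExponents ρ (fun i => (l i : ℝ)) = (P.support : Set (Fin n →₀ ℕ)) := by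
    ext A
    rw [Finset.mem_coe, hPsupp]
    simp only [minimalExponents, linForm_natCast, Set.mem_ofPred_eq, Nat.cast_le]
    refine and_congr_right fun hA => ⟨fun h => ?_, fun h B hB => h ▸ hge B hB⟩
    exact le_antisymm ((h A₀ hA₀'.1).trans hA₀'.2.le) (hge A hA)
  have hface : convexHull ℝ (exponentPoint '' (P.support : Set (Fin n →₀ ℕ))) =
      faceOf (newtonPolyhedron ρ) fun i => (l i : ℝ) := by
    rw [faceOf_newtonPolyhedron ⟨A₀, hA₀'.1⟩ hl', hmin]
  refine ⟨⟨?_, _, hl', hface⟩, ?_⟩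
  · exact (convexHull_nonempty_iff (𝕜 := ℝ)).2 ⟨_, A₀, hA₀, rfl⟩
  · rw [hface, initialForm]
    ext A
    have hmemface {B : Fin n →₀ ℕ} (hB : B ∈ ρ.support) :
        exponentPoint B ∈ faceOf (newtonPolyhedron ρ) (fun i => (l i : ℝ)) ↔ B ∈ P.support := by
      rw [exponentPoint_mem_faceOf_iff hB hl', ← Finset.mem_coe, ← hmin]
      exact ⟨fun h => ⟨hB, h⟩, fun h => h.2⟩
    rw [Finset.sum_congr (Finset.filter_congr fun B hB => hmemface hB) fun _ _ => rfl,
      MvPolynomial.coeff_sum]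
    simp only [MvPolynomial.coeff_monomial, Finset.sum_ite_eq', Finset.mem_filter,
      MvPolynomial.coeff_map]
    by_cases hA : A ∈ P.support
    · rw [if_pos ⟨(hPsupp.1 hA).1, hA⟩, hcoeff (hweight A hA)]
    · rw [if_neg fun h => hA h.2]
      by_contra h
      exact hA ((hzero hunit).2 (Ne.symm h))

end Faces

/-! ### Weights orthogonal to a lattice direction -/

section Direction

variable {n : ℕ}

/-- A weight with values in `ℕ` which is orthogonal to the lattice vector `c`. -/
def IsOrthogonalWeight (c : Fin n → ℤ) (w : Fin n → ℕ) : Prop :=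
  ∑ i, (w i : ℤ) * c i = 0

/-- A primitive lattice vector with entries of both signs. Primitivity is recorded by a linear
form with integer coefficients that takes the value one. -/
structure IsEdgeDirection (c : Fin n → ℤ) : Prop where
  primitive : ∃ u : Fin n → ℤ, ∑ i, u i * c i = 1
  exists_pos : ∃ i, 0 < c i
  exists_neg : ∃ i, c i < 0

theorem natCast_weight (w : Fin n → ℕ) (A : Fin n →₀ ℕ) :
    ((Finsupp.weight w A : ℕ) : ℤ) = ∑ i, (w i : ℤ) * A i := by
  simp [weight_eq_sum_mul]

theorem isOrthogonalWeight_single (c : Fin n → ℤ) {i : Fin n} (hi : c i = 0) :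
    IsOrthogonalWeight c (Pi.single i 1) := by
  refine Finset.sum_eq_zero fun k _ => ?_
  rcases eq_or_ne k i with rfl | h
  · simp [hi]
  · simp [h]

theorem sum_pair_mul (i j : Fin n) (a b : ℕ) (v : Fin n → ℤ) :
    ∑ k, (((Pi.single i a + Pi.single j b : Fin n → ℕ) k : ℕ) : ℤ) * v k = a * v i + b * v j := by
  have (k : Fin n) : (((Pi.single i a + Pi.single j b : Fin n → ℕ) k : ℕ) : ℤ) * v k =
      (if k = i then (a : ℤ) * v k else 0) + if k = j then (b : ℤ) * v k else 0 := by
    simp only [Pi.add_apply, Pi.single_apply]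
    split_ifs <;> push_cast <;> ring
  simp only [this, Finset.sum_add_distrib, Finset.sum_ite_eq', Finset.mem_univ, if_true]

theorem isOrthogonalWeight_pair {c : Fin n → ℤ} {i j : Fin n} (hi : 0 < c i) (hj : c j < 0) :
    IsOrthogonalWeight c (Pi.single i (c j).natAbs + Pi.single j (c i).natAbs) := by
  rw [IsOrthogonalWeight, sum_pair_mul]
  rw [Int.natCast_natAbs, Int.natCast_natAbs, abs_of_pos hi, abs_of_neg hj]
  ring

/-- The orthogonal weights detect whether a lattice vector is an integral multiple of `c`. -/
theorem IsEdgeDirection.exists_eq_mul {c : Fin n → ℤ} (hc : IsEdgeDirection c) {v : Fin n → ℤ}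
    (hv : ∀ w, IsOrthogonalWeight c w → ∑ i, (w i : ℤ) * v i = 0) :
    ∃ t : ℤ, ∀ i, v i = t * c i := by
  have hzero {i : Fin n} (hi : c i = 0) : v i = 0 := by
    have := hv _ (isOrthogonalWeight_single c hi)
    rw [Finset.sum_eq_single i] at this
    · simpa using this
    · intro k _ hk
      simp [hk]
    · simp
  have hpair {i j : Fin n} (hi : 0 < c i) (hj : c j < 0) : c i * v j = c j * v i := by
    have := hv _ (isOrthogonalWeight_pair hi hj)
    rw [sum_pair_mul, Int.natCast_natAbs, Int.natCast_natAbs, abs_of_pos hi, abs_of_neg hj] at this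
    linarith
  obtain ⟨i₀, hi₀⟩ := hc.exists_pos
  obtain ⟨j₀, hj₀⟩ := hc.exists_neg
  have hall (i : Fin n) : c i₀ * v i = c i * v i₀ := by
    rcases lt_trichotomy (c i) 0 with h | h | h
    · exact hpair hi₀ h
    · rw [hzero h, h]; ring
    · have h1 := hpair h hj₀
      have h2 := hpair hi₀ hj₀
      have h3 : c j₀ * (c i₀ * v i) = c j₀ * (c i * v i₀) := by
        linear_combination c i * h2 - c i₀ * h1
      exact mul_left_cancel₀ hj₀.ne h3
  obtain ⟨u, hu⟩ := hc.primitive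
  refine ⟨∑ k, u k * v k, fun i => ?_⟩
  have h1 : c i₀ * ((∑ k, u k * v k) * c i) = (∑ k, u k * c k) * (c i * v i₀) := by
    simp only [Finset.sum_mul, Finset.mul_sum]
    refine Finset.sum_congr rfl fun k _ => ?_
    linear_combination u k * c i * hall k
  rw [hu, one_mul, ← hall i] at h1
  exact (mul_left_cancel₀ hi₀.ne' h1).symm

theorem IsEdgeDirection.exists_pos_weight {c : Fin n → ℤ} (hc : IsEdgeDirection c) :
    ∃ w, IsOrthogonalWeight c w ∧ ∀ i, 0 < w i := by
  let p := ∑ i, (c i).toNat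
  let q := ∑ i, (-c i).toNat
  have hp : 0 < p := by
    obtain ⟨i, hi⟩ := hc.exists_pos
    exact Finset.sum_pos' (fun _ _ => Nat.zero_le _) ⟨i, Finset.mem_univ i, by omega⟩
  have hq : 0 < q := by
    obtain ⟨i, hi⟩ := hc.exists_neg
    exact Finset.sum_pos' (fun _ _ => Nat.zero_le _) ⟨i, Finset.mem_univ i, by omega⟩
  refine ⟨fun i => if 0 < c i then q else if c i < 0 then p else 1, ?_, fun i => ?_⟩
  · have h (i : Fin n) : (((if 0 < c i then q else if c i < 0 then p else 1 : ℕ) : ℕ) : ℤ) * c i =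
        q * ((c i).toNat : ℤ) - p * ((-c i).toNat : ℤ) := by
      split_ifs with h1 h2
      · rw [Int.toNat_of_nonneg h1.le, Int.toNat_of_nonpos (show -c i ≤ 0 by omega)]
        simp
      · rw [Int.toNat_of_nonneg (show 0 ≤ -c i by omega), Int.toNat_of_nonpos h2.le]
        simp
      · rw [show c i = 0 by omega]; simp
    rw [IsOrthogonalWeight, Finset.sum_congr rfl fun i _ => h i, Finset.sum_sub_distrib,
      ← Finset.mul_sum, ← Finset.mul_sum, ← Nat.cast_sum, ← Nat.cast_sum]
    exact sub_eq_zero.2 (mul_comm _ _)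
  · dsimp only
    split_ifs
    exacts [hq, hp, one_pos]

end Direction

/-! ### Polynomials supported on a line -/

section LineForm

variable {K : Type*} [Field K] {n : ℕ} (c : Fin n → ℤ)

/-- The exponent `Z + j c`. Negative entries are replaced by zero, so this is meaningful only
where `Z + j c` is nonnegative. -/
noncomputable def linePoint (Z : Fin n → ℤ) (j : ℕ) : Fin n →₀ ℕ :=
  Finsupp.equivFunOnFinite.symm fun i => (Z i + j * c i).toNat

@[simp]
theorem linePoint_apply (Z : Fin n → ℤ) (j : ℕ) (i : Fin n) :
    linePoint c Z j i = (Z i + j * c i).toNat := rfl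

/-- The exponents `Z + j c`, for `j` in the support of `p`, are nonnegative. -/
def OnLine (Z : Fin n → ℤ) (p : Polynomial K) : Prop :=
  ∀ j ∈ p.support, ∀ i, 0 ≤ Z i + j * c i

/-- The polynomial `∑ p_j X^(Z + j c)` attached to `p = ∑ p_j T^j`. -/
noncomputable def lineForm (Z : Fin n → ℤ) : Polynomial K →ₗ[K] MvPolynomial (Fin n) K :=
  Polynomial.lsum fun j => MvPolynomial.monomial (linePoint c Z j)

variable {c}

@[simp]
theorem lineForm_monomial (Z : Fin n → ℤ) (j : ℕ) (a : K) :
    lineForm c Z (Polynomial.monomial j a) = MvPolynomial.monomial (linePoint c Z j) a := by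
  simp [lineForm, Polynomial.lsum_apply, Polynomial.sum_monomial_index]

theorem lineForm_eq_sum (Z : Fin n → ℤ) (p : Polynomial K) :
    lineForm c Z p =
      ∑ j ∈ p.support, MvPolynomial.monomial (linePoint c Z j) (p.coeff j) := by
  conv_lhs => rw [p.as_sum_support]
  simp

theorem lineForm_mul {Z Z' : Fin n → ℤ} {p q : Polynomial K} (hp : OnLine c Z p)
    (hq : OnLine c Z' q) :
    lineForm c (Z + Z') (p * q) = lineForm c Z p * lineForm c Z' q := by
  rw [lineForm_eq_sum Z p, lineForm_eq_sum Z' q]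
  conv_lhs => rw [p.as_sum_support, q.as_sum_support]
  simp only [Finset.sum_mul, Finset.mul_sum, map_sum, Polynomial.monomial_mul_monomial,
    lineForm_monomial, MvPolynomial.monomial_mul]
  refine Finset.sum_congr rfl fun k hk => Finset.sum_congr rfl fun j hj => ?_
  congr 2
  ext i
  have h1 := hp _ hj i
  have h2 := hq _ hk i
  simp only [linePoint_apply, Finsupp.add_apply, Pi.add_apply]
  rw [← Int.toNat_add h1 h2]
  congr 1
  push_cast
  ring

theorem lineForm_mul_X_pow (Z : Fin n → ℤ) (p : Polynomial K) (s : ℕ) :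
    lineForm c (fun i => Z i - s * c i) (p * Polynomial.X ^ s) = lineForm c Z p := by
  induction p using Polynomial.induction_on' with
  | add p q hp hq => rw [add_mul, map_add, map_add, hp, hq]
  | monomial j a =>
    have : linePoint c (fun i => Z i - s * c i) (j + s) = linePoint c Z j := by
      ext i
      simp only [linePoint_apply]
      congr 1
      push_cast
      ring
    rw [Polynomial.monomial_mul_X_pow, lineForm_monomial, lineForm_monomial, this]

theorem exists_of_mem_support_lineForm {Z : Fin n → ℤ} {p : Polynomial K} {A : Fin n →₀ ℕ}
    (hA : A ∈ (lineForm c Z p).support) : ∃ j ∈ p.support, A = linePoint c Z j := by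
  classical
  rw [lineForm_eq_sum] at hA
  obtain ⟨j, hj, h⟩ := Finset.mem_biUnion.1 (MvPolynomial.support_sum hA)
  exact ⟨j, hj, Finset.mem_singleton.1 (MvPolynomial.support_monomial_subset h)⟩

theorem coeff_lineForm {Z : Fin n → ℤ} {p : Polynomial K} (hp : OnLine c Z p) {i₀ : Fin n}
    (hi₀ : c i₀ ≠ 0) {j : ℕ} (hj : ∀ i, 0 ≤ Z i + j * c i) :
    (lineForm c Z p).coeff (linePoint c Z j) = p.coeff j := by
  classical
  rw [lineForm_eq_sum, MvPolynomial.coeff_sum]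
  have h (k : ℕ) (hk : k ∈ p.support) :
      (MvPolynomial.monomial (linePoint c Z k) (p.coeff k)).coeff (linePoint c Z j) =
        if k = j then p.coeff k else 0 := by
    rw [MvPolynomial.coeff_monomial]
    congr 1
    refine propext ⟨fun h => ?_, fun h => h ▸ rfl⟩
    have h1 := DFunLike.congr_fun h i₀
    simp only [linePoint_apply] at h1
    have h2 := hp k hk i₀
    have h3 := hj i₀
    have h4 : (k : ℤ) * c i₀ = j * c i₀ := by omega
    exact_mod_cast mul_right_cancel₀ hi₀ h4
  rw [Finset.sum_congr rfl h, Finset.sum_ite_eq']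
  split_ifs with hjp
  · rfl
  · exact (Polynomial.notMem_support_iff.1 hjp).symm

theorem natCast_weight_linePoint {w : Fin n → ℕ} (hw : IsOrthogonalWeight c w) {Z : Fin n → ℤ}
    {j : ℕ} (hj : ∀ i, 0 ≤ Z i + j * c i) :
    ((Finsupp.weight w (linePoint c Z j) : ℕ) : ℤ) = ∑ i, (w i : ℤ) * Z i := by
  rw [natCast_weight]
  have (i : Fin n) : (w i : ℤ) * (linePoint c Z j i : ℕ) = w i * Z i + j * (w i * c i) := by
    rw [linePoint_apply, Int.toNat_of_nonneg (hj i)]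
    ring
  simp only [this, Finset.sum_add_distrib, ← Finset.mul_sum]
  rw [show ∑ i, (w i : ℤ) * c i = 0 from hw, mul_zero, add_zero]

theorem natCast_weight_of_mem_support_lineForm {w : Fin n → ℕ} (hw : IsOrthogonalWeight c w)
    {Z : Fin n → ℤ} {p : Polynomial K} (hp : OnLine c Z p) {A : Fin n →₀ ℕ}
    (hA : A ∈ (lineForm c Z p).support) :
    ((Finsupp.weight w A : ℕ) : ℤ) = ∑ i, (w i : ℤ) * Z i := by
  obtain ⟨j, hj, rfl⟩ := exists_of_mem_support_lineForm hA
  exact natCast_weight_linePoint hw (hp j hj)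

/-- If `q g` fits on the line based at `Z`, and `g` has nonzero constant term, then `q` fits on the
line based at `Z - deg g • c⁻`, because the products of the extreme terms of `q` and `g` survive in
`q g`. -/
theorem OnLine.of_mul {Z : Fin n → ℤ} {q g : Polynomial K} (hg : g.coeff 0 ≠ 0)
    (h : OnLine c Z (q * g)) :
    OnLine c (fun i => Z i - g.natDegree * ((-c i).toNat : ℤ)) q := by
  intro j hj i
  have hq : q ≠ 0 := by
    rintro rfl
    simp at hj
  have hg0 : g ≠ 0 := by
    rintro rfl
    simp at hg
  have hlow : (q * g).coeff q.natTrailingDegree ≠ 0 := by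
    have h1 : g.natTrailingDegree = 0 :=
      Nat.le_zero.1 (Polynomial.natTrailingDegree_le_of_ne_zero hg)
    have h2 := Polynomial.natTrailingDegree_mul hq hg0
    rw [h1, add_zero] at h2
    rw [← h2]
    exact Polynomial.trailingCoeff_nonzero_iff_nonzero.2 (mul_ne_zero hq hg0)
  have hhigh : (q * g).coeff (q.natDegree + g.natDegree) ≠ 0 := by
    rw [Polynomial.coeff_mul_degree_add_degree]
    exact mul_ne_zero (Polynomial.leadingCoeff_ne_zero.2 hq)
      (Polynomial.leadingCoeff_ne_zero.2 hg0)
  have h1 := h _ (Polynomial.mem_support_iff.2 hlow) i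
  have h2 := h _ (Polynomial.mem_support_iff.2 hhigh) i
  have h3 : (q.natTrailingDegree : ℤ) ≤ j := by
    exact_mod_cast Polynomial.natTrailingDegree_le_of_mem_supp j hj
  have h4 : (j : ℤ) ≤ q.natDegree := by
    exact_mod_cast Polynomial.le_natDegree_of_mem_supp j hj
  push_cast at h2
  dsimp only
  rcases le_total 0 (c i) with hc | hc
  · rw [Int.toNat_of_nonpos (by omega)]
    have := mul_le_mul_of_nonneg_right h3 hc
    push_cast
    linarith
  · rw [Int.toNat_of_nonneg (by omega)]
    have := mul_le_mul_of_nonpos_right h4 hc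
    linarith

theorem onLine_natDegree_mul (p : Polynomial K) :
    OnLine c (fun i => p.natDegree * ((-c i).toNat : ℤ)) p := by
  intro j hj i
  have h4 : (j : ℤ) ≤ p.natDegree := by
    exact_mod_cast Polynomial.le_natDegree_of_mem_supp j hj
  dsimp only
  rcases le_total 0 (c i) with hc | hc
  · rw [Int.toNat_of_nonpos (by omega)]
    have := mul_nonneg (Int.natCast_nonneg j) hc
    push_cast
    linarith
  · rw [Int.toNat_of_nonneg (by omega)]
    have := mul_le_mul_of_nonpos_right h4 hc
    linarith

/-- A nonzero polynomial that is homogeneous for all orthogonal weights is supported on a line. -/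
theorem IsEdgeDirection.exists_eq_lineForm (hc : IsEdgeDirection c) {P : MvPolynomial (Fin n) K}
    (hP : P ≠ 0) (hhom : ∀ w, IsOrthogonalWeight c w → ∀ A ∈ P.support, ∀ B ∈ P.support,
      Finsupp.weight w A = Finsupp.weight w B) :
    ∃ (B : Fin n →₀ ℕ) (p : Polynomial K), p.coeff 0 ≠ 0 ∧ OnLine c (fun i => (B i : ℤ)) p ∧
      lineForm c (fun i => (B i : ℤ)) p = P := by
  classical
  obtain ⟨u, hu⟩ := hc.primitive
  obtain ⟨B, hB, hBmin⟩ := P.support.exists_min_image (fun A => ∑ i, u i * (A i : ℤ))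
    (MvPolynomial.support_nonempty.2 hP)
  let idx : (Fin n →₀ ℕ) → ℕ := fun A => (∑ i, u i * (A i : ℤ) - ∑ i, u i * (B i : ℤ)).toNat
  have hidx {A : Fin n →₀ ℕ} (hA : A ∈ P.support) (i : Fin n) :
      (A i : ℤ) = B i + idx A * c i := by
    obtain ⟨t, ht⟩ := hc.exists_eq_mul (v := fun i => (A i : ℤ) - B i) fun w hw => by
      simp only [mul_sub, Finset.sum_sub_distrib, ← natCast_weight, hhom w hw A hA B hB, sub_self]
    have h1 : ∑ i, u i * (A i : ℤ) - ∑ i, u i * (B i : ℤ) = t := by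
      rw [← Finset.sum_sub_distrib]
      simp only [← mul_sub, ht]
      calc ∑ i, u i * (t * c i) = t * ∑ i, u i * c i := by
            rw [Finset.mul_sum]
            exact Finset.sum_congr rfl fun i _ => by ring
        _ = t := by rw [hu, mul_one]
    have h2 : (idx A : ℤ) = t := by
      have := hBmin A hA
      simp only [idx, h1]
      rw [Int.toNat_of_nonneg (by omega)]
    have := ht i
    rw [h2]
    linarith
  have hpoint {A : Fin n →₀ ℕ} (hA : A ∈ P.support) :
      linePoint c (fun i => (B i : ℤ)) (idx A) = A := by
    ext i
    rw [linePoint_apply, ← hidx hA i, Int.toNat_natCast]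
  let p : Polynomial K := ∑ A ∈ P.support, Polynomial.monomial (idx A) (P.coeff A)
  refine ⟨B, p, ?_, ?_, ?_⟩
  · simp only [p, Polynomial.finsetSum_coeff, Polynomial.coeff_monomial]
    rw [Finset.sum_eq_single B]
    · rw [if_pos (by simp [idx])]
      exact MvPolynomial.mem_support_iff.1 hB
    · intro A hA hAB
      refine if_neg fun h => hAB ?_
      rw [← hpoint hA, ← hpoint hB, h]
      simp [idx]
    · exact fun h => absurd hB h
  · intro j hj i
    obtain ⟨A, hA, h⟩ : ∃ A ∈ P.support, idx A = j := by
      by_contra! hcon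
      refine Polynomial.mem_support_iff.1 hj ?_
      simp only [p, Polynomial.finsetSum_coeff, Polynomial.coeff_monomial]
      exact Finset.sum_eq_zero fun A hA => if_neg (hcon A hA)
    rw [← h]
    dsimp only
    rw [← hidx hA i]
    exact Int.natCast_nonneg _
  · simp only [p, map_sum, lineForm_monomial]
    rw [Finset.sum_congr rfl fun A hA => by rw [hpoint hA]]
    exact P.support_sum_monomial_coeff

theorem exists_mem_support_apply_eq_zero {P : MvPolynomial (Fin n) K} {i : Fin n}
    (hP : ¬ MvPolynomial.X i ∣ P) : ∃ A ∈ P.support, A i = 0 := by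
  by_contra! hcon
  refine hP ?_
  rw [← P.support_sum_monomial_coeff]
  refine Finset.dvd_sum fun A hA => ⟨MvPolynomial.monomial (A - Finsupp.single i 1) (P.coeff A), ?_⟩
  rw [MvPolynomial.X, MvPolynomial.monomial_mul, one_mul, add_tsub_cancel_of_le]
  rw [Finsupp.single_le_iff]
  exact Nat.one_le_iff_ne_zero.2 (hcon A hA)

/-- A polynomial on a line that no variable divides starts at the exponent `natDegree • c⁻`. -/
theorem eq_natDegree_mul_of_not_X_dvd {B : Fin n →₀ ℕ} {p : Polynomial K}
    (hp : OnLine c (fun i => (B i : ℤ)) p) (hp0 : p.coeff 0 ≠ 0)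
    (hX : ∀ i, ¬ MvPolynomial.X i ∣ lineForm c (fun i => (B i : ℤ)) p) (i : Fin n) :
    B i = p.natDegree * (-c i).toNat := by
  obtain ⟨A, hA, hAi⟩ := exists_mem_support_apply_eq_zero (hX i)
  obtain ⟨j, hj, rfl⟩ := exists_of_mem_support_lineForm hA
  have h1 := hp j hj i
  have hpne : p ≠ 0 := fun h => by simp [h] at hp0
  have h2 := hp _ (Polynomial.natDegree_mem_support_of_nonzero hpne) i
  have h3 : (j : ℤ) ≤ p.natDegree := by
    exact_mod_cast Polynomial.le_natDegree_of_mem_supp j hj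
  rw [linePoint_apply] at hAi
  have h4 : (B i : ℤ) + j * c i = 0 := le_antisymm (Int.toNat_eq_zero.1 hAi) h1
  have h5 := Int.natCast_nonneg (B i)
  have h6 := Int.natCast_nonneg j
  zify
  rcases le_total 0 (c i) with hc | hc
  · rw [Int.toNat_of_nonpos (by omega)]
    have := mul_nonneg h6 hc
    push_cast
    linarith
  · rw [Int.toNat_of_nonneg (by omega)]
    have := mul_le_mul_of_nonpos_right h3 hc
    dsimp only at h2
    linarith

/-- A common factor `d` of `g` and `h` gives the common factor `∑ d_j X^(deg d • c⁻ + j c)` of the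
polynomials attached to them. -/
theorem IsEdgeDirection.isCoprime_of_isRelPrime (hc : IsEdgeDirection c) {Z Z' : Fin n → ℤ}
    {g h : Polynomial K} (hg : OnLine c Z g) (hh : OnLine c Z' h) (hg0 : g.coeff 0 ≠ 0)
    (hrel : IsRelPrime (lineForm c Z g) (lineForm c Z' h)) : IsCoprime g h := by
  classical
  rw [← EuclideanDomain.gcd_isUnit_iff]
  set d := EuclideanDomain.gcd g h
  obtain ⟨g', hg'⟩ : d ∣ g := EuclideanDomain.gcd_dvd_left g h
  obtain ⟨h', hh'⟩ : d ∣ h := EuclideanDomain.gcd_dvd_right g h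
  have hd0 : d.coeff 0 ≠ 0 := by
    intro h0
    rw [hg', Polynomial.mul_coeff_zero, h0, zero_mul] at hg0
    exact hg0 rfl
  let Y : Fin n → ℤ := fun i => d.natDegree * ((-c i).toNat : ℤ)
  have hdvd {W : Fin n → ℤ} {p p' : Polynomial K} (hp : OnLine c W p) (hpp : p = d * p') :
      lineForm c Y d ∣ lineForm c W p := by
    rw [hpp, mul_comm] at hp
    refine ⟨lineForm c (fun i => W i - Y i) p', ?_⟩
    rw [← lineForm_mul (onLine_natDegree_mul d) (OnLine.of_mul hd0 hp), hpp]
    congr 2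
    ext i
    simp
  have hunit := hrel (hdvd hg hg') (hdvd hh hh')
  rw [MvPolynomial.isUnit_iff_eq_C_of_isReduced] at hunit
  obtain ⟨a, -, ha⟩ := hunit
  obtain ⟨i₀, hi₀⟩ := hc.exists_neg
  have hcoeff := coeff_lineForm (onLine_natDegree_mul d) hi₀.ne (j := 0) (Z := Y)
    fun i => by simp only [Y, Nat.cast_zero, zero_mul, add_zero]; positivity
  rw [ha, MvPolynomial.coeff_C] at hcoeff
  have hzero : (0 : Fin n →₀ ℕ) = linePoint c Y 0 := by
    by_contra hne
    rw [if_neg hne] at hcoeff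
    exact hd0 hcoeff.symm
  have h1 := DFunLike.congr_fun hzero i₀
  rw [linePoint_apply] at h1
  simp only [Y, Finsupp.coe_zero, Pi.zero_apply, Nat.cast_zero, zero_mul, add_zero] at h1
  have h2 : (0 : ℤ) < ((-c i₀).toNat : ℤ) := by omega
  have h3 : d.natDegree = 0 := by
    by_contra h3
    have h4 : (0 : ℤ) < d.natDegree := by omega
    have := mul_pos h4 h2
    omega
  rw [Polynomial.isUnit_iff]
  refine ⟨d.coeff 0, isUnit_iff_ne_zero.2 hd0, ?_⟩
  exact (Polynomial.eq_C_of_natDegree_eq_zero h3).symm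

/-- The division step. The monomials `X^D` in the cone over the initial form `G * H` are
combinations of `G` and `H`, homogeneous for all orthogonal weights. In one variable this is
`T^r = b h T^s + q g` with `deg b < deg g`; the cone condition provides room for `b`, and the
support of `q g` provides room for `q`. -/
theorem IsEdgeDirection.exists_monomial_eq (hc : IsEdgeDirection c) {g h : Polynomial K}
    {A B : Fin n →₀ ℕ} (hA : ∀ i, A i = g.natDegree * (-c i).toNat)
    (hg0 : g.coeff 0 ≠ 0) (hcop : IsCoprime g h)
    (hg : OnLine c (fun i => (A i : ℤ)) g) (hh : OnLine c (fun i => (B i : ℤ)) h)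
    {D : Fin n →₀ ℕ} (hD : ∀ w, IsOrthogonalWeight c w →
      Finsupp.weight w A + Finsupp.weight w B ≤ Finsupp.weight w D) :
    ∃ b q : MvPolynomial (Fin n) K,
      MvPolynomial.monomial D 1 = b * lineForm c (fun i => (B i : ℤ)) h +
        q * lineForm c (fun i => (A i : ℤ)) g ∧
      (∀ F ∈ b.support, ∀ w, IsOrthogonalWeight c w →
        Finsupp.weight w F + Finsupp.weight w B = Finsupp.weight w D) ∧
      (∀ F ∈ q.support, ∀ w, IsOrthogonalWeight c w →
        Finsupp.weight w F + Finsupp.weight w A = Finsupp.weight w D) := by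
  classical
  -- the largest `j` with `D - B - j c` nonnegative in the coordinates where `c` is positive
  obtain ⟨i₀, hi₀, hmin⟩ := (Finset.univ.filter fun i => 0 < c i).exists_min_image
    (fun i => ((D i : ℤ) - B i) / c i) (by
      obtain ⟨i, hi⟩ := hc.exists_pos
      exact ⟨i, by simpa using hi⟩)
  replace hi₀ : 0 < c i₀ := by simpa using hi₀
  set j₀ := ((D i₀ : ℤ) - B i₀) / c i₀
  have hroom (i : Fin n) : ((g.natDegree : ℤ) - 1) * ((-c i).toNat : ℤ) ≤
      (D i : ℤ) - j₀ * c i - B i := by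
    rcases lt_trichotomy (c i) 0 with hi | hi | hi
    · have hw := hD _ (isOrthogonalWeight_pair hi₀ hi)
      zify at hw
      simp only [natCast_weight, sum_pair_mul] at hw
      rw [Int.natCast_natAbs, Int.natCast_natAbs, abs_of_pos hi₀, abs_of_neg hi] at hw
      have hA₀ : (A i₀ : ℤ) = 0 := by
        rw [hA, Int.toNat_of_nonpos (by omega)]; simp
      have hAi : (A i : ℤ) = g.natDegree * (-c i) := by
        rw [hA]
        rw [Nat.cast_mul, Int.toNat_of_nonneg (by omega)]
      rw [hA₀, hAi] at hw
      rw [Int.toNat_of_nonneg (by omega)]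
      have h1 : (D i₀ : ℤ) - B i₀ < c i₀ * (j₀ + 1) := by
        have := Int.lt_ediv_add_one_mul_self ((D i₀ : ℤ) - B i₀) hi₀
        linarith
      have h2 : c i₀ * ((g.natDegree - 1) * (-c i)) ≤ c i₀ * ((D i : ℤ) - j₀ * c i - B i) := by
        have h3 := mul_le_mul_of_nonneg_left h1.le (by omega : (0 : ℤ) ≤ -c i)
        nlinarith
      exact le_of_mul_le_mul_left h2 hi₀
    · have hw := hD _ (isOrthogonalWeight_single c hi)
      have hs (F : Fin n →₀ ℕ) : Finsupp.weight (Pi.single i 1 : Fin n → ℕ) F = F i := by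
        rw [weight_eq_sum_mul, Finset.sum_eq_single i]
        · simp
        · intro k _ hk
          simp [hk]
        · simp
      simp only [hs] at hw
      rw [hi]
      simp only [neg_zero, Int.toNat_zero, Nat.cast_zero, mul_zero, sub_zero]
      omega
    · rw [Int.toNat_of_nonpos (by omega)]
      have h1 := hmin i (by simpa using hi)
      have h2 : c i * (((D i : ℤ) - B i) / c i) ≤ (D i : ℤ) - B i :=
        Int.mul_ediv_self_le hi.ne'
      have h3 := mul_le_mul_of_nonneg_left h1 hi.le
      push_cast
      linarith
  let r := j₀.toNat
  let s := (-j₀).toNat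
  have hrs : (r : ℤ) - s = j₀ := by omega
  have hgX : IsCoprime g (h * Polynomial.X ^ s) := by
    refine hcop.mul_right (IsCoprime.pow_right ?_)
    rw [isCoprime_comm, Polynomial.irreducible_X.coprime_iff_not_dvd, Polynomial.X_dvd_iff]
    exact hg0
  obtain ⟨u, v, huv⟩ := hgX
  let b : Polynomial K := Polynomial.X ^ r * v % g
  let q : Polynomial K :=
    Polynomial.X ^ r * u + Polynomial.X ^ r * v / g * (h * Polynomial.X ^ s)
  have hT : Polynomial.X ^ r = b * (h * Polynomial.X ^ s) + q * g := by
    have h1 := EuclideanDomain.div_add_mod (Polynomial.X ^ r * v) g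
    calc Polynomial.X ^ r = Polynomial.X ^ r * (u * g + v * (h * Polynomial.X ^ s)) := by
          rw [huv, mul_one]
      _ = Polynomial.X ^ r * u * g + Polynomial.X ^ r * v * (h * Polynomial.X ^ s) := by ring
      _ = Polynomial.X ^ r * u * g +
          (g * (Polynomial.X ^ r * v / g) + Polynomial.X ^ r * v % g) *
            (h * Polynomial.X ^ s) := by rw [h1]
      _ = _ := by simp only [b, q]; ring
  have hgne : g ≠ 0 := fun h0 => by simp [h0] at hg0
  have hbdeg : ∀ j ∈ b.support, j < g.natDegree := by
    intro j hj
    have hb : b ≠ 0 := fun h0 => by simp [h0] at hj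
    exact (Polynomial.le_natDegree_of_mem_supp j hj).trans_lt
      (Polynomial.natDegree_lt_natDegree hb (EuclideanDomain.mod_lt _ hgne))
  -- base points of the lines that carry `X^D`, `b`, `h T^s` and `q`
  let Z : Fin n → ℤ := fun i => (D i : ℤ) - r * c i
  let Q : Fin n → ℤ := fun i => (D i : ℤ) - j₀ * c i - B i
  let Bs : Fin n → ℤ := fun i => (B i : ℤ) - s * c i
  have hZ : Q + Bs = Z := by
    ext i
    simp only [Q, Bs, Z, Pi.add_apply]
    rw [← hrs]
    ring
  have hb : OnLine c Q b := by
    intro j hj i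
    have h1 := hroom i
    have h2 := hbdeg j hj
    simp only [Q]
    rcases le_total 0 (c i) with hi | hi
    · rw [Int.toNat_of_nonpos (by omega)] at h1
      have := mul_nonneg (Int.natCast_nonneg j) hi
      push_cast at h1
      linarith
    · rw [Int.toNat_of_nonneg (by omega)] at h1
      have h3 : (j : ℤ) ≤ g.natDegree - 1 := by omega
      have := mul_le_mul_of_nonpos_right h3 hi
      linarith
  have hhs : OnLine c Bs (h * Polynomial.X ^ s) := by
    intro j hj i
    rw [Polynomial.mem_support_iff, Polynomial.coeff_mul_X_pow'] at hj
    split_ifs at hj with hsj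
    · have := hh _ (Polynomial.mem_support_iff.2 hj) i
      simp only [Bs]
      push_cast [hsj] at this
      linarith
    · exact absurd rfl hj
  have hqg : OnLine c Z (q * g) := by
    have h1 : q * g = Polynomial.X ^ r - b * (h * Polynomial.X ^ s) := by rw [hT]; ring
    intro j hj i
    rw [h1] at hj
    have hcase : j = r ∨ j ∈ (b * (h * Polynomial.X ^ s)).support := by
      by_contra! hcon
      refine Polynomial.mem_support_iff.1 hj ?_
      rw [Polynomial.coeff_sub, Polynomial.coeff_X_pow, if_neg hcon.1,
        Polynomial.notMem_support_iff.1 hcon.2, sub_zero]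
    rcases hcase with rfl | hj
    · simp [Z]
    · rw [Polynomial.mem_support_iff, Polynomial.coeff_mul] at hj
      obtain ⟨⟨j₁, j₂⟩, hj₁₂, hne⟩ := Finset.exists_ne_zero_of_sum_ne_zero hj
      rw [← Finset.HasAntidiagonal.mem_antidiagonal.1 hj₁₂]
      have h2 := hb j₁ (Polynomial.mem_support_iff.2 (left_ne_zero_of_mul hne)) i
      have h3 := hhs j₂ (Polynomial.mem_support_iff.2 (right_ne_zero_of_mul hne)) i
      rw [← hZ]
      push_cast
      simp only [Pi.add_apply]
      linarith
  have hq : OnLine c (fun i => Z i - A i) q := by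
    have := OnLine.of_mul hg0 hqg
    simpa only [hA, Nat.cast_mul] using this
  have hZw {w : Fin n → ℕ} (hw : IsOrthogonalWeight c w) (t : ℤ) :
      ∑ i, (w i : ℤ) * (D i - t * c i) = Finsupp.weight w D := by
    have (i : Fin n) : (w i : ℤ) * (D i - t * c i) = w i * D i - t * (w i * c i) := by ring
    simp only [this, Finset.sum_sub_distrib, ← Finset.mul_sum]
    rw [show ∑ i, (w i : ℤ) * c i = 0 from hw, mul_zero, sub_zero, natCast_weight]
  refine ⟨lineForm c Q b, lineForm c (fun i => Z i - A i) q, ?_, ?_, ?_⟩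
  · rw [← lineForm_mul_X_pow (fun i => (B i : ℤ)) h s, ← lineForm_mul hb hhs,
      ← lineForm_mul hq hg, hZ]
    have h1 : (fun i => Z i - (A i : ℤ)) + (fun i => (A i : ℤ)) = Z := by
      ext i
      simp
    have h2 : linePoint c Z r = D := by
      ext i
      simp [Z]
    rw [h1, ← map_add, ← hT, ← Polynomial.monomial_one_right_eq_X_pow, lineForm_monomial, h2]
  · intro F hF w hw
    have h1 := natCast_weight_of_mem_support_lineForm hw hb hF
    have h2 : ∑ i, (w i : ℤ) * Q i = Finsupp.weight w D - Finsupp.weight w B := by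
      rw [← hZw hw j₀, natCast_weight w B, ← Finset.sum_sub_distrib]
      exact Finset.sum_congr rfl fun i _ => by simp only [Q]; ring
    omega
  · intro F hF w hw
    have h1 := natCast_weight_of_mem_support_lineForm hw hq hF
    have h2 : ∑ i, (w i : ℤ) * (Z i - A i) = Finsupp.weight w D - Finsupp.weight w A := by
      rw [← hZw hw r, natCast_weight w A, ← Finset.sum_sub_distrib]
      exact Finset.sum_congr rfl fun i _ => by simp only [Z]; ring
    omega

end LineForm

/-! ### Factors of weighted homogeneous polynomials -/

section Homogeneous

variable {K : Type*} [Field K] {n : ℕ}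

/-- Substituting `X i * T^(w i)` for `X i` turns a weighted homogeneous polynomial into a monomial
in `T`, and the factors of a monomial in `T` are monomials in `T`. -/
theorem weight_eq_of_mem_support_of_mul (w : Fin n → ℕ) {G H : MvPolynomial (Fin n) K}
    (hne : G * H ≠ 0) (hhom : ∀ A ∈ (G * H).support, ∀ B ∈ (G * H).support,
      Finsupp.weight w A = Finsupp.weight w B) {A B : Fin n →₀ ℕ} (hA : A ∈ G.support)
    (hB : B ∈ G.support) : Finsupp.weight w A = Finsupp.weight w B := by
  classical
  let τ : MvPolynomial (Fin n) K →ₐ[K] Polynomial (MvPolynomial (Fin n) K) :=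
    MvPolynomial.aeval fun i => Polynomial.C (MvPolynomial.X i) * Polynomial.X ^ w i
  have hτm (D : Fin n →₀ ℕ) (a : K) : τ (MvPolynomial.monomial D a) =
      Polynomial.monomial (Finsupp.weight w D) (MvPolynomial.monomial D a) := by
    have h1 : MvPolynomial.monomial D a = MvPolynomial.C a * ∏ i, MvPolynomial.X i ^ D i := by
      rw [MvPolynomial.monomial_eq, Finsupp.prod_fintype _ _ fun _ => pow_zero _]
    rw [← Polynomial.C_mul_X_pow_eq_monomial, h1, map_mul, map_prod]
    simp only [map_pow, τ, MvPolynomial.aeval_X, MvPolynomial.aeval_C, mul_pow, map_mul,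
      Finset.prod_mul_distrib, map_prod, ← pow_mul, Finset.prod_pow_eq_pow_sum,
      weight_eq_sum_mul]
    rw [IsScalarTower.algebraMap_apply K (MvPolynomial (Fin n) K), ← mul_assoc]
    rfl
  have hτ (P : MvPolynomial (Fin n) K) {D : Fin n →₀ ℕ} (hD : D ∈ P.support) :
      (τ P).coeff (Finsupp.weight w D) ≠ 0 := by
    intro h0
    have h1 : ((τ P).coeff (Finsupp.weight w D)).coeff D = P.coeff D := by
      conv_lhs => rw [← P.support_sum_monomial_coeff]
      simp only [map_sum, hτm, Polynomial.finsetSum_coeff, Polynomial.coeff_monomial,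
        MvPolynomial.coeff_sum]
      rw [Finset.sum_eq_single D]
      · simp
      · intro E _ hE
        split_ifs
        · rw [MvPolynomial.coeff_monomial, if_neg hE]
        · simp
      · exact fun h => absurd hD h
    rw [h0] at h1
    exact MvPolynomial.mem_support_iff.1 hD h1.symm
  obtain ⟨D, hD⟩ := MvPolynomial.support_nonempty.2 hne
  have hprod : τ G * τ H = Polynomial.monomial (Finsupp.weight w D) (G * H) := by
    rw [← map_mul]
    conv_lhs => rw [← (G * H).support_sum_monomial_coeff]
    conv_rhs => rw [← (G * H).support_sum_monomial_coeff]
    simp only [map_sum, hτm]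
    exact Finset.sum_congr rfl fun E hE => by rw [hhom E hE D hD]
  have hprod0 : τ G * τ H ≠ 0 := by
    rw [hprod, ne_eq, Polynomial.monomial_eq_zero_iff]
    exact hne
  have h1 := Polynomial.natDegree_mul (left_ne_zero_of_mul hprod0) (right_ne_zero_of_mul hprod0)
  have h2 := Polynomial.natTrailingDegree_mul (left_ne_zero_of_mul hprod0)
    (right_ne_zero_of_mul hprod0)
  rw [hprod, Polynomial.natDegree_monomial_eq _ hne] at h1
  rw [hprod, Polynomial.natTrailingDegree_monomial hne] at h2
  have h3 := Polynomial.natTrailingDegree_le_natDegree (τ G)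
  have h4 := Polynomial.natTrailingDegree_le_natDegree (τ H)
  have h5 := Polynomial.le_natDegree_of_ne_zero (hτ G hA)
  have h6 := Polynomial.le_natDegree_of_ne_zero (hτ G hB)
  have h7 := Polynomial.natTrailingDegree_le_of_ne_zero (hτ G hA)
  have h8 := Polynomial.natTrailingDegree_le_of_ne_zero (hτ G hB)
  omega

end Homogeneous

/-! ### The geometry of a loose edge -/

section LooseEdge

variable {n : ℕ}

theorem linForm_sub (l v w : Fin n → ℝ) : linForm l (v - w) = linForm l v - linForm l w := by
  rw [eq_sub_iff_add_eq, ← linForm_add, sub_add_cancel]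

theorem vectorSpan_convexHull_eq (s : Set (Fin n → ℝ)) :
    vectorSpan ℝ (convexHull ℝ s) = vectorSpan ℝ s := by
  rw [← direction_affineSpan, affineSpan_convexHull, direction_affineSpan]

/-- All exponents lie above a loose edge, as seen along the direction of the edge. Otherwise,
moving the linear form that cuts out the edge towards a form orthogonal to the edge with a smaller
value elsewhere, one meets a compact face of dimension at least two that contains the edge. -/
theorem IsLooseEdge.linForm_pos {R : Type*} [CommRing R] {ρ : MvPolynomial (Fin n) R}
    {E : Set (Fin n → ℝ)} (hE : IsLooseEdge (newtonPolyhedron ρ) E) {l₀ : Fin n → ℝ}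
    (hl₀ : ∀ i, 0 < l₀ i) (hEl : E = faceOf (newtonPolyhedron ρ) l₀) {l : Fin n → ℝ}
    (hl : ∀ i, 0 < l i) (hlE : ∀ v ∈ vectorSpan ℝ E, linForm l v = 0)
    {A D : Fin n →₀ ℕ} (hA : A ∈ ρ.support) (hAE : exponentPoint A ∈ E) (hD : D ∈ ρ.support)
    (hDE : exponentPoint D ∉ E) : 0 < linForm l (exponentPoint D - exponentPoint A) := by
  classical
  by_contra hneg
  have hmem {B : Fin n →₀ ℕ} (hB : B ∈ ρ.support) :
      exponentPoint B ∈ E ↔ B ∈ minimalExponents ρ l₀ := by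
    rw [hEl, exponentPoint_mem_faceOf_iff hB hl₀]
    exact ⟨fun h => ⟨hB, h⟩, fun h => h.2⟩
  let a : (Fin n →₀ ℕ) → ℝ := fun B => linForm l₀ (exponentPoint B - exponentPoint A)
  let b : (Fin n →₀ ℕ) → ℝ := fun B => linForm l (exponentPoint B - exponentPoint A)
  have ha {B : Fin n →₀ ℕ} (hB : B ∈ ρ.support) (hBE : exponentPoint B ∉ E) : 0 < a B := by
    by_contra h
    refine hBE ((hmem hB).2 ⟨hB, fun C hC => ?_⟩)
    have h1 := ((hmem hA).1 hAE).2 C hC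
    simp only [a, linForm_sub] at h
    linarith
  have hzero {B : Fin n →₀ ℕ} (hBE : exponentPoint B ∈ E) : a B = 0 ∧ b B = 0 := by
    refine ⟨?_, hlE _ (vsub_mem_vectorSpan ℝ hBE hAE)⟩
    have h1 := hBE
    have h2 := hAE
    rw [hEl] at h1 h2
    simp only [a, linForm_sub]
    exact sub_eq_zero.2 (le_antisymm (h1.2 _ h2.1) (h2.2 _ h1.1))
  let bad := ρ.support.filter fun B => exponentPoint B ∉ E ∧ b B ≤ 0
  obtain ⟨D, hDbad, hmin⟩ := bad.exists_min_image (fun B => a B / (a B - b B))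
    ⟨D, Finset.mem_filter.2 ⟨hD, hDE, not_lt.1 hneg⟩⟩
  obtain ⟨hD, hDE, hbD⟩ := Finset.mem_filter.1 hDbad
  have haD := ha hD hDE
  set t := a D / (a D - b D)
  have ht0 : 0 < t := div_pos haD (by linarith)
  have ht1 : t ≤ 1 := (div_le_one (by linarith)).2 (by linarith)
  have htD : (1 - t) * a D + t * b D = 0 := by
    have : t * (a D - b D) = a D := div_mul_cancel₀ _ (by linarith)
    linarith
  let l' : Fin n → ℝ := (1 - t) • l₀ + t • l
  have hl' : ∀ i, 0 < l' i := fun i =>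
    add_pos_of_nonneg_of_pos (mul_nonneg (by linarith) (hl₀ i).le) (mul_pos ht0 (hl i))
  have hl'eq (B : Fin n →₀ ℕ) :
      linForm l' (exponentPoint B - exponentPoint A) = (1 - t) * a B + t * b B := by
    simp only [l', a, b, linForm, Finset.mul_sum, ← Finset.sum_add_distrib]
    refine Finset.sum_congr rfl fun i _ => ?_
    simp only [Pi.add_apply, Pi.smul_apply, smul_eq_mul]
    ring
  have hnonneg {B : Fin n →₀ ℕ} (hB : B ∈ ρ.support) : 0 ≤ (1 - t) * a B + t * b B := by
    by_cases hBE : exponentPoint B ∈ E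
    · rw [(hzero hBE).1, (hzero hBE).2]
      simp
    · have haB := ha hB hBE
      rcases lt_or_ge 0 (b B) with hb | hb
      · exact add_nonneg (mul_nonneg (by linarith) haB.le) (mul_pos ht0 hb).le
      · have h1 := hmin B (Finset.mem_filter.2 ⟨hB, hBE, hb⟩)
        rw [le_div_iff₀ (by linarith)] at h1
        linarith
  have hmin' {B : Fin n →₀ ℕ} (hB : B ∈ ρ.support) (h0 : (1 - t) * a B + t * b B = 0) :
      B ∈ minimalExponents ρ l' := by
    refine ⟨hB, fun C hC => ?_⟩
    have h1 := hnonneg hC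
    rw [← hl'eq, linForm_sub] at h0 h1
    linarith
  have hne : ρ.support.Nonempty := ⟨A, hA⟩
  let F := faceOf (newtonPolyhedron ρ) l'
  have hF : F = convexHull ℝ (exponentPoint '' minimalExponents ρ l') :=
    faceOf_newtonPolyhedron hne hl'
  have hEF : E ⊆ F := by
    rw [hF, hEl, faceOf_newtonPolyhedron hne hl₀]
    refine convexHull_mono (Set.image_mono fun B hB => hmin' hB.1 ?_)
    have := hzero ((hmem hB.1).2 hB)
    rw [this.1, this.2]
    simp
  have hDF : exponentPoint D ∈ F := by
    rw [hF]
    exact subset_convexHull ℝ _ ⟨D, hmin' hD htD, rfl⟩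
  have hdimF : ¬ 2 ≤ faceDim F :=
    hE.loose F ⟨⟨_, hDF⟩, l', hl', rfl⟩ hEF
  have hle : vectorSpan ℝ E ≤ vectorSpan ℝ F := vectorSpan_mono ℝ hEF
  have heq : vectorSpan ℝ E = vectorSpan ℝ F := by
    refine Submodule.eq_of_le_of_finrank_le hle ?_
    have h1 : Module.finrank ℝ (vectorSpan ℝ E) = 1 := hE.faceDim_eq_one
    have h2 : ¬ 2 ≤ Module.finrank ℝ (vectorSpan ℝ F) := hdimF
    omega
  have hDmem : exponentPoint D - exponentPoint A ∈ vectorSpan ℝ E := by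
    rw [heq]
    exact vsub_mem_vectorSpan ℝ hDF (hEF hAE)
  -- the form defining the edge vanishes on the direction of the edge
  have hvanish : ∀ v ∈ vectorSpan ℝ E, linForm l₀ v = 0 := by
    have hker : vectorSpan ℝ E ≤ LinearMap.ker ((isLinearMap_linForm l₀).mk' (linForm l₀)) := by
      rw [vectorSpan_def, Submodule.span_le]
      rintro _ ⟨p, hp, q, hq, rfl⟩
      rw [hEl] at hp hq
      rw [SetLike.mem_coe, LinearMap.mem_ker, IsLinearMap.mk'_apply]
      change linForm l₀ (p - q) = 0
      rw [linForm_sub]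
      exact sub_eq_zero.2 (le_antisymm (hp.2 _ hq.1) (hq.2 _ hp.1))
    exact fun v hv => hker hv
  exact haD.ne' (hvanish _ hDmem)

/-- A nonzero lattice vector is a multiple of a primitive one. -/
theorem exists_primitive_of_ne_zero {v : Fin n → ℤ} (hv : v ≠ 0) :
    ∃ (g : ℤ) (c u : Fin n → ℤ), g ≠ 0 ∧ (∀ i, v i = g * c i) ∧ ∑ i, u i * c i = 1 := by
  let I : Ideal ℤ := Ideal.span (Set.range v)
  let g := Submodule.IsPrincipal.generator I
  have hgI : Ideal.span {g} = I := Ideal.span_singleton_generator I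
  have hdvd (i : Fin n) : g ∣ v i := by
    rw [← Ideal.mem_span_singleton, hgI]
    exact Ideal.subset_span ⟨i, rfl⟩
  choose c hc using hdvd
  have hg : g ≠ 0 := by
    intro h
    refine hv (funext fun i => ?_)
    rw [hc i, h, zero_mul]
    rfl
  obtain ⟨u, hu⟩ := (Ideal.mem_span_range_iff_exists_fun).1
    (show g ∈ Ideal.span (Set.range v) from Submodule.IsPrincipal.generator_mem I)
  refine ⟨g, c, u, hg, hc, mul_left_cancel₀ hg ?_⟩
  rw [mul_one, Finset.mul_sum]
  conv_rhs => rw [← hu]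
  exact Finset.sum_congr rfl fun i _ => by rw [hc i]; ring

/-- A loose edge has a primitive direction `c`, and all exponents lie in `A + ℝ c + ℝⁿ_{≥ 0}` for
any exponent `A` on the edge; the orthogonal weights express this. A positive orthogonal weight
is minimal only on the edge. -/
theorem IsLooseEdge.exists_direction {R : Type*} [CommRing R] {ρ : MvPolynomial (Fin n) R}
    {E : Set (Fin n → ℝ)} (hE : IsLooseEdge (newtonPolyhedron ρ) E) :
    ∃ c : Fin n → ℤ, IsEdgeDirection c ∧
      E = convexHull ℝ (exponentPoint '' {A | A ∈ ρ.support ∧ exponentPoint A ∈ E}) ∧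
      ∃ A ∈ ρ.support, exponentPoint A ∈ E ∧
        (∀ D ∈ ρ.support, exponentPoint D ∈ E → ∀ w, IsOrthogonalWeight c w →
          Finsupp.weight w D = Finsupp.weight w A) ∧
        (∀ D ∈ ρ.support, ∀ w, IsOrthogonalWeight c w →
          Finsupp.weight w A ≤ Finsupp.weight w D) ∧
        (∀ D ∈ ρ.support, exponentPoint D ∉ E → ∀ w, IsOrthogonalWeight c w → (∀ i, 0 < w i) →
          Finsupp.weight w A < Finsupp.weight w D) := by
  classical
  obtain ⟨hEne, l₀, hl₀, hEl⟩ := hE.isCompactFace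
  have hne : ρ.support.Nonempty := by
    by_contra h
    rw [Finset.not_nonempty_iff_eq_empty] at h
    obtain ⟨v, hv⟩ := hEne
    rw [hEl] at hv
    have := hv.1
    rw [newtonPolyhedron_eq, h] at this
    simp at this
  have hT : {A | A ∈ ρ.support ∧ exponentPoint A ∈ E} = minimalExponents ρ l₀ := by
    ext B
    refine and_congr_right fun hB => ?_
    rw [hEl, exponentPoint_mem_faceOf_iff hB hl₀]
  have hull : E = convexHull ℝ (exponentPoint '' {A | A ∈ ρ.support ∧ exponentPoint A ∈ E}) := by
    rw [hT, ← faceOf_newtonPolyhedron hne hl₀]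
    exact hEl
  have hspan : vectorSpan ℝ E =
      vectorSpan ℝ (exponentPoint '' {A | A ∈ ρ.support ∧ exponentPoint A ∈ E}) := by
    conv_lhs => rw [hull]
    exact vectorSpan_convexHull_eq _
  obtain ⟨A, ⟨hA, hAE⟩, A', ⟨hA', hAE'⟩, hAA⟩ :
      {A | A ∈ ρ.support ∧ exponentPoint A ∈ E}.Nontrivial := by
    by_contra hcon
    rw [Set.not_nontrivial_iff] at hcon
    have h1 : Module.finrank ℝ (vectorSpan ℝ E) = 1 := hE.faceDim_eq_one
    rw [hspan, vectorSpan_of_subsingleton ℝ (hcon.image _)] at h1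
    simp at h1
  obtain ⟨g, c, u, hg, hgc, hu⟩ := exists_primitive_of_ne_zero
    (v := fun i => (A' i : ℤ) - A i) (by
      intro h
      refine hAA (Finsupp.ext fun i => ?_)
      have := congrFun h i
      simp only [Pi.zero_apply] at this
      omega)
  have hv₀ : exponentPoint A' - exponentPoint A ∈ vectorSpan ℝ E :=
    vsub_mem_vectorSpan ℝ hAE' hAE
  have hv₀eq : exponentPoint A' - exponentPoint A = fun i => (g : ℝ) * c i := by
    ext i
    have := congrArg (Int.cast : ℤ → ℝ) (hgc i)
    push_cast at this
    simpa [exponentPoint] using this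
  have hv₀ne : exponentPoint A' - exponentPoint A ≠ 0 :=
    sub_ne_zero.2 fun h => hAA (exponentPoint_injective h).symm
  have hline : ∀ v ∈ vectorSpan ℝ E, ∃ r : ℝ, v = r • (exponentPoint A' - exponentPoint A) := by
    intro v hv
    obtain ⟨r, hr⟩ := exists_smul_eq_of_finrank_eq_one
      (show Module.finrank ℝ (vectorSpan ℝ E) = 1 from hE.faceDim_eq_one)
      (x := ⟨_, hv₀⟩) (by simpa [Subtype.ext_iff] using hv₀ne) ⟨v, hv⟩
    exact ⟨r, (congrArg Subtype.val hr).symm⟩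
  have hl₀c : ∑ i, l₀ i * (c i : ℝ) = 0 := by
    have h1 : linForm l₀ (exponentPoint A' - exponentPoint A) = 0 := by
      have h1 := hAE
      have h2 := hAE'
      rw [hEl] at h1 h2
      rw [linForm_sub]
      exact sub_eq_zero.2 (le_antisymm (h2.2 _ h1.1) (h1.2 _ h2.1))
    rw [hv₀eq] at h1
    have h2 : (g : ℝ) * ∑ i, l₀ i * (c i : ℝ) = 0 := by
      rw [← h1, linForm, Finset.mul_sum]
      exact Finset.sum_congr rfl fun i _ => by ring
    exact (mul_eq_zero.1 h2).resolve_left (by exact_mod_cast hg)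
  have hc0 : ∃ i, c i ≠ 0 := by
    by_contra! h
    simp [h] at hu
  have hc : IsEdgeDirection c := by
    refine ⟨⟨u, hu⟩, ?_, ?_⟩
    · by_contra! h
      obtain ⟨i, hi⟩ := hc0
      have hterm : ∀ k ∈ Finset.univ, l₀ k * (c k : ℝ) ≤ 0 := fun k _ =>
        mul_nonpos_of_nonneg_of_nonpos (hl₀ k).le (by exact_mod_cast h k)
      have := (Finset.sum_eq_zero_iff_of_nonpos hterm).1 hl₀c i (Finset.mem_univ i)
      exact hi (by exact_mod_cast (mul_eq_zero.1 this).resolve_left (hl₀ i).ne')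
    · by_contra! h
      obtain ⟨i, hi⟩ := hc0
      have hterm : ∀ k ∈ Finset.univ, 0 ≤ l₀ k * (c k : ℝ) := fun k _ =>
        mul_nonneg (hl₀ k).le (by exact_mod_cast h k)
      have := (Finset.sum_eq_zero_iff_of_nonneg hterm).1 hl₀c i (Finset.mem_univ i)
      exact hi (by exact_mod_cast (mul_eq_zero.1 this).resolve_left (hl₀ i).ne')
  have horth {l : Fin n → ℝ} (hl : ∑ i, l i * (c i : ℝ) = 0) :
      ∀ v ∈ vectorSpan ℝ E, linForm l v = 0 := by
    intro v hv
    obtain ⟨r, rfl⟩ := hline v hv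
    rw [linForm_smul, hv₀eq]
    have : linForm l (fun i => (g : ℝ) * c i) = g * ∑ i, l i * (c i : ℝ) := by
      rw [linForm, Finset.mul_sum]
      exact Finset.sum_congr rfl fun i _ => by ring
    rw [this, hl, mul_zero, mul_zero]
  have hw' {w : Fin n → ℕ} (hw : IsOrthogonalWeight c w) :
      ∑ i, ((w i : ℕ) : ℝ) * (c i : ℝ) = 0 := by
    have := congrArg (Int.cast : ℤ → ℝ) (show ∑ i, (w i : ℤ) * c i = 0 from hw)
    push_cast at this
    exact this
  have hEqual : ∀ D ∈ ρ.support, exponentPoint D ∈ E → ∀ w, IsOrthogonalWeight c w →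
      Finsupp.weight w D = Finsupp.weight w A := by
    intro D _ hDE w hw
    have h1 := horth (hw' hw) _ (vsub_mem_vectorSpan ℝ hDE hAE)
    rw [vsub_eq_sub, linForm_sub, linForm_natCast, linForm_natCast, sub_eq_zero] at h1
    exact_mod_cast h1
  refine ⟨c, hc, hull, A, hA, hAE, hEqual, ?_, ?_⟩
  · intro D hD w hw
    by_cases hDE : exponentPoint D ∈ E
    · exact (hEqual D hD hDE w hw).ge
    · by_contra! hlt
      set y := linForm (fun i => ((w i : ℕ) : ℝ)) (exponentPoint D - exponentPoint A) with hy
      have hy0 : y < 0 := by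
        rw [hy, linForm_sub, linForm_natCast, linForm_natCast, sub_neg]
        exact_mod_cast hlt
      set z := linForm l₀ (exponentPoint D - exponentPoint A) with hz
      have hz0 : 0 < z := hE.linForm_pos hl₀ hEl hl₀ (horth hl₀c) hA hAE hD hDE
      -- the perturbation `w + ε l₀` of `w` is positive, and takes the value zero at `D - A`
      let ε := -y / z
      have hε : 0 < ε := div_pos (by linarith) hz0
      have hpos := hE.linForm_pos hl₀ hEl (l := fun i => (w i : ℝ) + ε * l₀ i)
        (fun i => add_pos_of_nonneg_of_pos (Nat.cast_nonneg _) (mul_pos hε (hl₀ i)))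
        (horth (by
          have : ∑ i, ((w i : ℝ) + ε * l₀ i) * (c i : ℝ) =
              ∑ i, (w i : ℝ) * (c i : ℝ) + ε * ∑ i, l₀ i * (c i : ℝ) := by
            rw [Finset.mul_sum, ← Finset.sum_add_distrib]
            exact Finset.sum_congr rfl fun i _ => by ring
          rw [this, hw' hw, hl₀c]
          ring)) hA hAE hD hDE
      have hval : linForm (fun i => (w i : ℝ) + ε * l₀ i)
          (exponentPoint D - exponentPoint A) = y + ε * z := by
        rw [hy, hz]
        simp only [linForm]
        rw [Finset.mul_sum, ← Finset.sum_add_distrib]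
        exact Finset.sum_congr rfl fun i _ => by ring
      rw [hval] at hpos
      have : ε * z = -y := div_mul_cancel₀ _ hz0.ne'
      linarith
  · intro D hD hDE w hw hwpos
    have h1 := hE.linForm_pos hl₀ hEl (l := fun i => ((w i : ℕ) : ℝ))
      (fun i => by exact_mod_cast hwpos i) (horth (hw' hw)) hA hAE hD hDE
    rw [linForm_sub, linForm_natCast, linForm_natCast, sub_pos] at h1
    exact_mod_cast h1

end LooseEdge

/-! ### Newton polytopes of polynomials on a line -/

section Segment

variable {K : Type*} [Field K] {n : ℕ} {c : Fin n → ℤ}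

theorem convexHull_support_lineForm {B : Fin n →₀ ℕ} {p : Polynomial K} (hp0 : p.coeff 0 ≠ 0)
    (hp : OnLine c (fun i => (B i : ℤ)) p) {i₀ : Fin n} (hi₀ : c i₀ ≠ 0) :
    convexHull ℝ (exponentPoint ''
      ((lineForm c (fun i => (B i : ℤ)) p).support : Set (Fin n →₀ ℕ))) =
      {v | ∃ r : ℝ, 0 ≤ r ∧ r ≤ p.natDegree ∧ v = fun i => (B i : ℝ) + r * c i} := by
  have hpoint {j : ℕ} (hj : ∀ i, 0 ≤ (B i : ℤ) + j * c i) :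
      exponentPoint (linePoint c (fun i => (B i : ℤ)) j) = fun i => (B i : ℝ) + j * c i := by
    ext i
    have := congrArg (Int.cast : ℤ → ℝ) (Int.toNat_of_nonneg (hj i))
    push_cast at this
    simpa [exponentPoint] using this
  have hpne : p ≠ 0 := fun h => by simp [h] at hp0
  have hvertex {j : ℕ} (hj : p.coeff j ≠ 0) : (fun i => (B i : ℝ) + j * c i) ∈ convexHull ℝ
      (exponentPoint '' ((lineForm c (fun i => (B i : ℤ)) p).support : Set (Fin n →₀ ℕ))) := by
    have hj' := hp j (Polynomial.mem_support_iff.2 hj)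
    refine subset_convexHull ℝ _ ⟨linePoint c (fun i => (B i : ℤ)) j, ?_, hpoint hj'⟩
    rw [Finset.mem_coe, MvPolynomial.mem_support_iff, coeff_lineForm hp hi₀ hj']
    exact hj
  apply Set.Subset.antisymm
  · refine convexHull_min ?_ ?_
    · rintro _ ⟨A, hA, rfl⟩
      obtain ⟨j, hj, rfl⟩ := exists_of_mem_support_lineForm hA
      exact ⟨j, Nat.cast_nonneg j, by exact_mod_cast Polynomial.le_natDegree_of_mem_supp j hj,
        hpoint (hp j hj)⟩
    · rintro _ ⟨r, hr0, hr1, rfl⟩ _ ⟨s, hs0, hs1, rfl⟩ a b ha hb hab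
      refine ⟨a * r + b * s, by positivity, ?_, ?_⟩
      · have : (p.natDegree : ℝ) = a * p.natDegree + b * p.natDegree := by
          rw [← add_mul, hab, one_mul]
        rw [this]
        exact add_le_add (mul_le_mul_of_nonneg_left hr1 ha) (mul_le_mul_of_nonneg_left hs1 hb)
      · ext i
        simp only [Pi.add_apply, Pi.smul_apply, smul_eq_mul]
        linear_combination (B i : ℝ) * hab
  · rintro _ ⟨r, hr0, hr1, rfl⟩
    have h0 := hvertex hp0
    have h1 := hvertex (Polynomial.leadingCoeff_ne_zero.2 hpne)
    rcases Nat.eq_zero_or_pos p.natDegree with hk | hk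
    · rw [hk, Nat.cast_zero] at hr1
      have hr : r = ((0 : ℕ) : ℝ) := by simpa using le_antisymm hr1 hr0
      rw [hr]
      exact h0
    · have hk' : (0 : ℝ) < p.natDegree := by exact_mod_cast hk
      have := convex_convexHull ℝ (exponentPoint ''
        ((lineForm c (fun i => (B i : ℤ)) p).support : Set (Fin n →₀ ℕ))) h0 h1
        (a := 1 - r / p.natDegree) (b := r / p.natDegree)
        (sub_nonneg.2 ((div_le_one hk').2 hr1)) (by positivity) (by ring)
      convert this using 1
      ext i
      simp only [Pi.add_apply, Pi.smul_apply, smul_eq_mul, Nat.cast_zero, zero_mul, add_zero]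
      field_simp
      ring

theorem faceDim_convexHull_support_lineForm_le {B : Fin n →₀ ℕ} {p : Polynomial K}
    (hp0 : p.coeff 0 ≠ 0) (hp : OnLine c (fun i => (B i : ℤ)) p) {i₀ : Fin n} (hi₀ : c i₀ ≠ 0) :
    faceDim (convexHull ℝ (exponentPoint ''
      ((lineForm c (fun i => (B i : ℤ)) p).support : Set (Fin n →₀ ℕ)))) ≤ 1 := by
  rw [convexHull_support_lineForm hp0 hp hi₀, faceDim]
  have hle : vectorSpan ℝ
      {v | ∃ r : ℝ, 0 ≤ r ∧ r ≤ p.natDegree ∧ v = fun i => (B i : ℝ) + r * c i} ≤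
      Submodule.span ℝ {fun i => (c i : ℝ)} := by
    rw [vectorSpan_def, Submodule.span_le]
    rintro _ ⟨_, ⟨r, -, -, rfl⟩, _, ⟨s, -, -, rfl⟩, rfl⟩
    refine Submodule.mem_span_singleton.2 ⟨r - s, ?_⟩
    ext i
    simp only [vsub_eq_sub, Pi.sub_apply, Pi.smul_apply, smul_eq_mul]
    ring
  refine (Submodule.finrank_mono hle).trans ?_
  simpa using! finrank_span_le_card (R := ℝ) ({fun i => (c i : ℝ)} : Set (Fin n → ℝ))

theorem convexHull_support_lineForm_mul {A B : Fin n →₀ ℕ} {g h : Polynomial K}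
    (hg0 : g.coeff 0 ≠ 0) (hh0 : h.coeff 0 ≠ 0) (hg : OnLine c (fun i => (A i : ℤ)) g)
    (hh : OnLine c (fun i => (B i : ℤ)) h) {i₀ : Fin n} (hi₀ : c i₀ ≠ 0) :
    convexHull ℝ (exponentPoint '' ((lineForm c (fun i => (A i : ℤ)) g *
      lineForm c (fun i => (B i : ℤ)) h).support : Set (Fin n →₀ ℕ))) =
    convexHull ℝ (exponentPoint ''
      ((lineForm c (fun i => (A i : ℤ)) g).support : Set (Fin n →₀ ℕ))) +
    convexHull ℝ (exponentPoint ''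
      ((lineForm c (fun i => (B i : ℤ)) h).support : Set (Fin n →₀ ℕ))) := by
  have hsum : (fun i => (A i : ℤ)) + (fun i => (B i : ℤ)) = fun i => ((A + B) i : ℤ) := by
    ext i
    simp
  have hgh0 : (g * h).coeff 0 ≠ 0 := by
    rw [Polynomial.mul_coeff_zero]
    exact mul_ne_zero hg0 hh0
  have hgh : OnLine c (fun i => ((A + B) i : ℤ)) (g * h) := by
    intro j hj i
    rw [Polynomial.mem_support_iff, Polynomial.coeff_mul] at hj
    obtain ⟨⟨j₁, j₂⟩, hj₁₂, hne⟩ := Finset.exists_ne_zero_of_sum_ne_zero hj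
    rw [← Finset.HasAntidiagonal.mem_antidiagonal.1 hj₁₂]
    have h1 := hg j₁ (Polynomial.mem_support_iff.2 (left_ne_zero_of_mul hne)) i
    have h2 := hh j₂ (Polynomial.mem_support_iff.2 (right_ne_zero_of_mul hne)) i
    dsimp only at h1 h2 ⊢
    rw [Finsupp.add_apply]
    push_cast
    linarith
  have hgne : g ≠ 0 := fun h => by simp [h] at hg0
  have hhne : h ≠ 0 := fun h => by simp [h] at hh0
  rw [← lineForm_mul hg hh, hsum, convexHull_support_lineForm hgh0 hgh hi₀,
    convexHull_support_lineForm hg0 hg hi₀, convexHull_support_lineForm hh0 hh hi₀,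
    Polynomial.natDegree_mul hgne hhne]
  apply Set.Subset.antisymm
  · rintro _ ⟨r, hr0, hr1, rfl⟩
    push_cast at hr1
    refine ⟨_, ⟨min r g.natDegree, le_min hr0 (Nat.cast_nonneg _), min_le_right _ _, rfl⟩, _,
      ⟨r - min r g.natDegree, sub_nonneg.2 (min_le_left _ _), ?_, rfl⟩, ?_⟩
    · rcases min_cases r (g.natDegree : ℝ) with ⟨h1, h2⟩ | ⟨h1, h2⟩
      · rw [h1, sub_self]
        exact Nat.cast_nonneg _
      · rw [h1]
        linarith
    · ext i
      simp only [Pi.add_apply, Finsupp.add_apply]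
      push_cast
      ring
  · rintro _ ⟨_, ⟨r, hr0, hr1, rfl⟩, _, ⟨s, hs0, hs1, rfl⟩, rfl⟩
    refine ⟨r + s, add_nonneg hr0 hs0, ?_, ?_⟩
    · push_cast
      exact add_le_add hr1 hs1
    · ext i
      simp only [Pi.add_apply, Finsupp.add_apply]
      push_cast
      ring

end Segment

/-! ### Lifting the factorization -/

section Lifting

variable {S : Type*} [CommRing S] {n : ℕ}

/-- The ideal generated by the monomials `x^D` with `D` in `A + ℝ c + ℝⁿ_{≥ 0}`, a condition
expressed by the weights orthogonal to `c`, and with `ω`-weight at least `ω·A + t`. -/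
def coneIdeal (x : Fin n → S) (c : Fin n → ℤ) (ω : Fin n → ℕ) (A : Fin n →₀ ℕ) (t : ℕ) :
    Ideal S :=
  monomialIdeal x {D | (∀ w, IsOrthogonalWeight c w → Finsupp.weight w A ≤ Finsupp.weight w D) ∧
    Finsupp.weight ω A + t ≤ Finsupp.weight ω D}

variable {x : Fin n → S} {c : Fin n → ℤ} {ω : Fin n → ℕ}

theorem coneIdeal_anti (A : Fin n →₀ ℕ) {s t : ℕ} (h : s ≤ t) :
    coneIdeal x c ω A t ≤ coneIdeal x c ω A s :=
  monomialIdeal_mono x fun _ hD => ⟨hD.1, by have := hD.2; omega⟩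

theorem coneIdeal_le_weightIdeal (A : Fin n →₀ ℕ) (t : ℕ) :
    coneIdeal x c ω A t ≤ weightIdeal x ω (Finsupp.weight ω A + t) :=
  monomialIdeal_mono x fun _ hD => hD.2

theorem mul_mem_coneIdeal {A B : Fin n →₀ ℕ} {s t r : ℕ} {a b : S}
    (ha : a ∈ coneIdeal x c ω A s) (hb : b ∈ coneIdeal x c ω B t) (hr : r ≤ s + t) :
    a * b ∈ coneIdeal x c ω (A + B) r := by
  refine coneIdeal_anti _ hr (monomialIdeal_mono x ?_ (monomialIdeal_mul_le x _ _
    (Ideal.mul_mem_mul ha hb)))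
  rintro _ ⟨D, hD, D', hD', rfl⟩
  refine ⟨fun w hw => ?_, ?_⟩
  · simpa using add_le_add (hD.1 w hw) (hD'.1 w hw)
  · have h1 := hD.2
    have h2 := hD'.2
    simp only [map_add]
    omega

theorem eval_mem_coneIdeal {A : Fin n →₀ ℕ} {t : ℕ} {P : MvPolynomial (Fin n) S}
    (hP : ∀ D ∈ P.support, (∀ w, IsOrthogonalWeight c w →
      Finsupp.weight w A ≤ Finsupp.weight w D) ∧ Finsupp.weight ω A + t ≤ Finsupp.weight ω D) :
    MvPolynomial.eval x P ∈ coneIdeal x c ω A t := by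
  rw [eval_eq_sum_monomialAt]
  exact Ideal.sum_mem _ fun D hD =>
    Ideal.mul_mem_left _ _ (monomialAt_mem_monomialIdeal x (hP D hD))

/-- Coefficients in the ideal generated by the `x i` increase the weight. -/
theorem eval_mem_coneIdeal_succ (hω : ∀ i, 0 < ω i) {A : Fin n →₀ ℕ} {t : ℕ}
    {P : MvPolynomial (Fin n) S}
    (hP : ∀ D ∈ P.support, (∀ w, IsOrthogonalWeight c w →
      Finsupp.weight w A ≤ Finsupp.weight w D) ∧ Finsupp.weight ω A + t ≤ Finsupp.weight ω D)
    (hcoeff : ∀ D, P.coeff D ∈ Ideal.span (Set.range x)) :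
    MvPolynomial.eval x P ∈ coneIdeal x c ω A (t + 1) := by
  rw [eval_eq_sum_monomialAt]
  refine Ideal.sum_mem _ fun D hD => ?_
  have hle : Ideal.span (Set.range x) * Ideal.span {monomialAt x D} ≤
      coneIdeal x c ω A (t + 1) := by
    rw [Ideal.span_mul_span', Ideal.span_le]
    rintro _ ⟨_, ⟨i, rfl⟩, _, rfl, rfl⟩
    change x i * monomialAt x D ∈ coneIdeal x c ω A (t + 1)
    rw [← monomialAt_single x i, ← monomialAt_add]
    refine monomialAt_mem_monomialIdeal x ⟨fun w hw => ?_, ?_⟩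
    · rw [map_add]
      exact ((hP D hD).1 w hw).trans (Nat.le_add_left _ _)
    · rw [map_add, Finsupp.weight_single, one_smul]
      have h1 := (hP D hD).2
      have h2 := hω i
      omega
  exact hle (Ideal.mul_mem_mul (hcoeff D) (Ideal.mem_span_singleton_self _))

/-- Hensel lifting along a cone. If every monomial in the cone over `G * H` is, modulo the ideal
`I = (x)`, a homogeneous combination of `G` and `H`, then an element that agrees with `G * H` up to
terms of larger weight in the cone is a product of elements with leading parts `G` and `H`. -/
theorem exists_mul_eq_of_division {I : Ideal S} [IsAdicComplete I S]
    (hI : Ideal.span (Set.range x) = I) (horth : IsOrthogonalWeight c ω) (hω : ∀ i, 0 < ω i)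
    {A B : Fin n →₀ ℕ} {G H : MvPolynomial (Fin n) S}
    (hG : ∀ F ∈ G.support, ∀ w, IsOrthogonalWeight c w → Finsupp.weight w F = Finsupp.weight w A)
    (hH : ∀ F ∈ H.support, ∀ w, IsOrthogonalWeight c w → Finsupp.weight w F = Finsupp.weight w B)
    (hdiv : ∀ D : Fin n →₀ ℕ, (∀ w, IsOrthogonalWeight c w →
        Finsupp.weight w A + Finsupp.weight w B ≤ Finsupp.weight w D) →
      ∃ b q : MvPolynomial (Fin n) S,
        (∀ F ∈ b.support, ∀ w, IsOrthogonalWeight c w →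
          Finsupp.weight w F + Finsupp.weight w B = Finsupp.weight w D) ∧
        (∀ F ∈ q.support, ∀ w, IsOrthogonalWeight c w →
          Finsupp.weight w F + Finsupp.weight w A = Finsupp.weight w D) ∧
        ∀ F, (MvPolynomial.monomial D 1 - b * H - q * G).coeff F ∈ I)
    {f : S} (hf : f - MvPolynomial.eval x G * MvPolynomial.eval x H ∈
      coneIdeal x c ω (A + B) 1) :
    ∃ g h : S, f = g * h ∧
      g - MvPolynomial.eval x G ∈ weightIdeal x ω (Finsupp.weight ω A + 1) ∧
      h - MvPolynomial.eval x H ∈ weightIdeal x ω (Finsupp.weight ω B + 1) := by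
  classical
  set G' := MvPolynomial.eval x G
  set H' := MvPolynomial.eval x H
  -- division of an error term by `G` and `H`, up to terms of larger weight
  have hstep (t : ℕ) (r : S) (hr : r ∈ coneIdeal x c ω (A + B) t) :
      ∃ β κ, β ∈ coneIdeal x c ω A t ∧ κ ∈ coneIdeal x c ω B t ∧
        r - β * H' - κ * G' ∈ coneIdeal x c ω (A + B) (t + 1) := by
    rw [coneIdeal, monomialIdeal] at hr
    induction hr using Submodule.span_induction with
    | mem r hr =>
      obtain ⟨D, ⟨hD, hDω⟩, rfl⟩ := hr
      simp only [map_add] at hD hDω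
      obtain ⟨b, q, hb, hq, hcoeff⟩ := hdiv D hD
      refine ⟨MvPolynomial.eval x b, MvPolynomial.eval x q, ?_, ?_, ?_⟩
      · refine eval_mem_coneIdeal fun F hF => ⟨fun w hw => ?_, ?_⟩
        · have h1 := hb F hF w hw
          have h2 := hD w hw
          omega
        · have h1 := hb F hF ω horth
          omega
      · refine eval_mem_coneIdeal fun F hF => ⟨fun w hw => ?_, ?_⟩
        · have h1 := hq F hF w hw
          have h2 := hD w hw
          omega
        · have h1 := hq F hF ω horth
          omega
      · have hweight : ∀ F ∈ (MvPolynomial.monomial D 1 - b * H - q * G).support,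
            ∀ w, IsOrthogonalWeight c w → Finsupp.weight w F = Finsupp.weight w D := by
          intro F hF w hw
          rcases Finset.mem_union.1 (MvPolynomial.support_sub _ _ _ hF) with hF | hF
          · rcases Finset.mem_union.1 (MvPolynomial.support_sub _ _ _ hF) with hF | hF
            · rw [Finset.mem_singleton.1 (MvPolynomial.support_monomial_subset hF)]
            · obtain ⟨F₁, hF₁, F₂, hF₂, rfl⟩ := Finset.mem_add.1 (MvPolynomial.support_mul _ _ hF)
              rw [map_add, hH F₂ hF₂ w hw, hb F₁ hF₁ w hw]
          · obtain ⟨F₁, hF₁, F₂, hF₂, rfl⟩ := Finset.mem_add.1 (MvPolynomial.support_mul _ _ hF)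
            rw [map_add, hG F₂ hF₂ w hw, hq F₁ hF₁ w hw]
        have := eval_mem_coneIdeal_succ (x := x) (c := c) hω (A := A + B) (t := t)
          (P := MvPolynomial.monomial D 1 - b * H - q * G) (fun F hF => ⟨fun w hw => by
            rw [hweight F hF w hw, map_add]
            exact hD w hw, by
            rw [hweight F hF ω horth, map_add]
            exact hDω⟩) (by rw [hI]; exact hcoeff)
        simpa only [map_sub, map_mul] using! this
    | zero => exact ⟨0, 0, zero_mem _, zero_mem _, by simp⟩
    | add r r' _ _ ih ih' =>
      obtain ⟨β, κ, h1, h2, h3⟩ := ih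
      obtain ⟨β', κ', h1', h2', h3'⟩ := ih'
      refine ⟨β + β', κ + κ', add_mem h1 h1', add_mem h2 h2', ?_⟩
      convert add_mem h3 h3' using 1
      ring
    | smul a r _ ih =>
      obtain ⟨β, κ, h1, h2, h3⟩ := ih
      refine ⟨a * β, a * κ, Ideal.mul_mem_left _ _ h1, Ideal.mul_mem_left _ _ h2, ?_⟩
      convert Ideal.mul_mem_left _ a h3 using 1
      rw [smul_eq_mul]
      ring
  -- approximate factorizations, together with their precision
  let approx : ℕ → Set (S × S) := fun t => {u | u.1 - G' ∈ coneIdeal x c ω A 1 ∧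
    u.2 - H' ∈ coneIdeal x c ω B 1 ∧ f - u.1 * u.2 ∈ coneIdeal x c ω (A + B) (t + 1)}
  have hnext (t : ℕ) (u : S × S) (hu : u ∈ approx t) : ∃ u' ∈ approx (t + 1),
      u'.1 - u.1 ∈ coneIdeal x c ω A (t + 1) ∧ u'.2 - u.2 ∈ coneIdeal x c ω B (t + 1) := by
    obtain ⟨h1, h2, h3⟩ := hu
    obtain ⟨β, κ, hβ, hκ, hr⟩ := hstep (t + 1) _ h3
    refine ⟨(u.1 + β, u.2 + κ), ⟨?_, ?_, ?_⟩, by simpa using hβ, by simpa using hκ⟩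
    · convert add_mem h1 (coneIdeal_anti A (Nat.le_add_left 1 t) hβ) using 1
      ring
    · convert add_mem h2 (coneIdeal_anti B (Nat.le_add_left 1 t) hκ) using 1
      ring
    · have e1 := mul_mem_coneIdeal hβ h2 (r := t + 1 + 1) le_rfl
      have e2 := mul_mem_coneIdeal h1 hκ (r := t + 1 + 1) (by omega)
      have e3 := mul_mem_coneIdeal hβ hκ (r := t + 1 + 1) (by omega)
      convert sub_mem (sub_mem (sub_mem hr e1) e2) e3 using 1
      ring
  choose! next hnext_mem hnext_left hnext_right using hnext
  let u : ℕ → S × S := fun t => Nat.rec (G', H') next t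
  have hu (t : ℕ) : u t ∈ approx t := by
    induction t with
    | zero => exact ⟨by simp [u], by simp [u], hf⟩
    | succ t ih => exact hnext_mem t _ ih
  have hleft {s t : ℕ} (hst : s ≤ t) : (u t).1 - (u s).1 ∈ coneIdeal x c ω A s := by
    induction t, hst using Nat.le_induction with
    | base => simp
    | succ t hst ih =>
      have h1 := coneIdeal_anti A (by omega : s ≤ t + 1) (hnext_left t _ (hu t))
      convert add_mem h1 ih using 1
      ring
  have hright {s t : ℕ} (hst : s ≤ t) : (u t).2 - (u s).2 ∈ coneIdeal x c ω B s := by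
    induction t, hst using Nat.le_induction with
    | base => simp
    | succ t hst ih =>
      have h1 := coneIdeal_anti B (by omega : s ≤ t + 1) (hnext_right t _ (hu t))
      convert add_mem h1 ih using 1
      ring
  -- weight `W * k` forces order `k`
  let W := ∑ i, ω i + 1
  have hpow (D : Fin n →₀ ℕ) (k : ℕ) : coneIdeal x c ω D (W * k) ≤ I ^ k := by
    rw [← hI]
    refine (coneIdeal_le_weightIdeal D _).trans ((weightIdeal_anti x ω (Nat.le_add_left _ _)).trans
      (weightIdeal_le_span_range_pow x (Nat.succ_pos _) (fun i => ?_) k))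
    exact (Finset.single_le_sum (fun _ _ => Nat.zero_le _) (Finset.mem_univ i)).trans
      (Nat.le_succ _)
  obtain ⟨g, hg⟩ := exists_adic_limit (I := I) (fun k => (u (W * k)).1) fun k =>
    hpow A k (hleft (Nat.mul_le_mul_left W (Nat.le_succ k)))
  obtain ⟨h, hh⟩ := exists_adic_limit (I := I) (fun k => (u (W * k)).2) fun k =>
    hpow B k (hright (Nat.mul_le_mul_left W (Nat.le_succ k)))
  refine ⟨g, h, ?_, ?_, ?_⟩
  · rw [← sub_eq_zero]
    refine eq_zero_of_forall_mem_pow (I := I) fun k => ?_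
    have h1 := hpow (A + B) k (coneIdeal_anti _ (Nat.le_succ _) (hu (W * k)).2.2)
    have h2 := Ideal.mul_mem_right h _ (hg k)
    have h3 := Ideal.mul_mem_left _ (u (W * k)).1 (hh k)
    convert sub_mem (sub_mem h1 h2) h3 using 1
    ring
  · have h1 := hg (Finsupp.weight ω A + 1)
    rw [← hI] at h1
    have h2 := coneIdeal_le_weightIdeal A 1 (hu (W * (Finsupp.weight ω A + 1))).1
    convert add_mem (span_range_pow_le_weightIdeal x hω _ h1) h2 using 1
    ring
  · have h1 := hh (Finsupp.weight ω B + 1)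
    rw [← hI] at h1
    have h2 := coneIdeal_le_weightIdeal B 1 (hu (W * (Finsupp.weight ω B + 1))).2.1
    convert add_mem (span_range_pow_le_weightIdeal x hω _ h1) h2 using 1
    ring

end Lifting

/-! ### Lifting coefficients from the residue field -/

section CoefficientLift

variable {K S : Type*} [Field K] [CommRing S] {n : ℕ}

/-- The polynomial with coefficients `s a` in place of `a`. -/
noncomputable def coefficientLift (s : K → S) (P : MvPolynomial (Fin n) K) :
    MvPolynomial (Fin n) S :=
  ∑ A ∈ P.support, MvPolynomial.monomial A (s (P.coeff A))

theorem coeff_coefficientLift {s : K → S} (hs : s 0 = 0) (P : MvPolynomial (Fin n) K)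
    (A : Fin n →₀ ℕ) : (coefficientLift s P).coeff A = s (P.coeff A) := by
  classical
  rw [coefficientLift, MvPolynomial.coeff_sum]
  simp only [MvPolynomial.coeff_monomial, Finset.sum_ite_eq']
  split_ifs with h
  · rfl
  · rw [MvPolynomial.notMem_support_iff.1 h, hs]

theorem support_coefficientLift_subset {s : K → S} (hs : s 0 = 0) (P : MvPolynomial (Fin n) K) :
    (coefficientLift s P).support ⊆ P.support := by
  intro A hA
  rw [MvPolynomial.mem_support_iff, coeff_coefficientLift hs] at hA
  rw [MvPolynomial.mem_support_iff]
  intro h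
  rw [h, hs] at hA
  exact hA rfl

variable [IsLocalRing S] {κ : K →+* ResidueField S} {s : K → S}

theorem map_residue_coefficientLift (hs : s 0 = 0) (hκ : ∀ a, residue S (s a) = κ a)
    (P : MvPolynomial (Fin n) K) :
    MvPolynomial.map (residue S) (coefficientLift s P) = MvPolynomial.map κ P := by
  ext A
  rw [MvPolynomial.coeff_map, MvPolynomial.coeff_map, coeff_coefficientLift hs, hκ]

theorem isUnit_coeff_coefficientLift (hs : s 0 = 0) (hκ : ∀ a, residue S (s a) = κ a)
    {P : MvPolynomial (Fin n) K} {A : Fin n →₀ ℕ} (hA : A ∈ P.support) :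
    IsUnit ((coefficientLift s P).coeff A) := by
  rw [coeff_coefficientLift hs, ← residue_ne_zero_iff_isUnit, hκ]
  exact (map_ne_zero κ).2 (MvPolynomial.mem_support_iff.1 hA)

theorem support_coefficientLift (hs : s 0 = 0) (hκ : ∀ a, residue S (s a) = κ a)
    (P : MvPolynomial (Fin n) K) : (coefficientLift s P).support = P.support := by
  refine (support_coefficientLift_subset hs P).antisymm fun A hA => ?_
  rw [MvPolynomial.mem_support_iff]
  exact (isUnit_coeff_coefficientLift hs hκ hA).ne_zero

theorem coeff_mem_maximalIdeal_of_map_residue_eq_zero {P : MvPolynomial (Fin n) S}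
    (hP : MvPolynomial.map (residue S) P = 0) (A : Fin n →₀ ℕ) : P.coeff A ∈ maximalIdeal S := by
  rw [← residue_eq_zero_iff, ← MvPolynomial.coeff_map, hP, MvPolynomial.coeff_zero]

/-- The form of `hasInitialFormAlong_of_sub_mem` for a polynomial `P` over another field `K` that
maps to the residue field, as `R / m` does to the residue field of the completion of `R`. -/
theorem hasInitialFormAlong_of_coefficientLift [IsAdicComplete (maximalIdeal S) S] {x : Fin n → S}
    (hx : MonomialsIndependent x) (hspan : Ideal.span (Set.range x) = maximalIdeal S)
    (hs : s 0 = 0) (hκ : ∀ a, residue S (s a) = κ a) {ω : Fin n → ℕ} (hω : ∀ i, 0 < ω i)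
    {P : MvPolynomial (Fin n) K} (hP : P ≠ 0) {e : ℕ}
    (hweight : ∀ A ∈ P.support, Finsupp.weight ω A = e) {g : S}
    (hg : g - MvPolynomial.eval x (coefficientLift s P) ∈ weightIdeal x ω (e + 1)) :
    HasInitialFormAlong x g
      (convexHull ℝ (exponentPoint '' (P.support : Set (Fin n →₀ ℕ))))
      (MvPolynomial.map κ P) := by
  have hsupp := support_coefficientLift hs hκ P
  have := hasInitialFormAlong_of_sub_mem hx hspan hω (P := coefficientLift s P)
    (by rw [← MvPolynomial.support_nonempty, hsupp]; exact MvPolynomial.support_nonempty.2 hP)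
    (fun A hA => isUnit_coeff_coefficientLift hs hκ (hsupp ▸ hA))
    (fun A hA => hweight A (hsupp ▸ hA)) hg
  rwa [hsupp, map_residue_coefficientLift hs hκ] at this

end CoefficientLift

section InitialForm

variable {R : Type*} [CommRing R] [IsLocalRing R] {n : ℕ}

open Classical in
theorem coeff_initialForm (ρ : MvPolynomial (Fin n) R) (E : Set (Fin n → ℝ)) (A : Fin n →₀ ℕ) :
    (initialForm ρ E).coeff A = if exponentPoint A ∈ E then residue R (ρ.coeff A) else 0 := by
  rw [initialForm, MvPolynomial.coeff_sum]
  simp only [MvPolynomial.coeff_monomial, Finset.sum_ite_eq', Finset.mem_filter,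
    MvPolynomial.mem_support_iff]
  by_cases h1 : ρ.coeff A = 0 <;> by_cases h2 : exponentPoint A ∈ E <;> simp [h1, h2]

theorem mem_support_initialForm {ρ : MvPolynomial (Fin n) R}
    (hρ : ∀ A ∈ ρ.support, IsUnit (ρ.coeff A)) {E : Set (Fin n → ℝ)} {A : Fin n →₀ ℕ} :
    A ∈ (initialForm ρ E).support ↔ A ∈ ρ.support ∧ exponentPoint A ∈ E := by
  classical
  rw [MvPolynomial.mem_support_iff, coeff_initialForm]
  by_cases hA : A ∈ ρ.support
  · have := residue_ne_zero_iff_isUnit _ |>.2 (hρ A hA)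
    by_cases h2 : exponentPoint A ∈ E <;> simp [h2, hA, this]
  · simp [MvPolynomial.notMem_support_iff.1 hA, hA]

end InitialForm

/-! ### The factorization theorem -/

theorem theorem1p1 {R : Type*} [CommRing R] [IsRegularLocalRing R] {n : ℕ} (x : Fin n → R)
    (hx : IsRegularSystemOfParameters x) (f : R) (ρ : MvPolynomial (Fin n) R)
    (hρ : IsExpansion x f ρ) (E : Set (Fin n → ℝ)) (hE : IsLooseEdge (newtonPolyhedron ρ) E)
    (G H : MvPolynomial (Fin n) (ResidueField R)) (hGH : initialForm ρ E = G * H)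
    (hcop : IsRelPrime G H) (hG : ∀ i, ¬ MvPolynomial.X i ∣ G) :
    ∃ (g h : AdicCompletion (maximalIdeal R) R) (E₁ E₂ : Set (Fin n → ℝ)),
      algebraMap R (AdicCompletion (maximalIdeal R) R) f = g * h ∧
      HasInitialFormAlong (fun i => algebraMap R (AdicCompletion (maximalIdeal R) R) (x i)) g E₁
        (MvPolynomial.map
          (ResidueField.map (algebraMap R (AdicCompletion (maximalIdeal R) R))) G) ∧
      HasInitialFormAlong (fun i => algebraMap R (AdicCompletion (maximalIdeal R) R) (x i)) h E₂
        (MvPolynomial.map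
          (ResidueField.map (algebraMap R (AdicCompletion (maximalIdeal R) R))) H) ∧
      faceDim E₁ ≤ 1 ∧ faceDim E₂ ≤ 1 ∧ E = E₁ + E₂ := by
  classical
  obtain ⟨c, hc, hull, A₀, hA₀, hA₀E, hEw, hcone, hstrict⟩ := hE.exists_direction
  obtain ⟨ω, hωc, hω⟩ := hc.exists_pos_weight
  have hsuppE {D : Fin n →₀ ℕ} :
      D ∈ (G * H).support ↔ D ∈ ρ.support ∧ exponentPoint D ∈ E := by
    rw [← hGH]
    exact mem_support_initialForm hρ.isUnit_coeff
  have hne : G * H ≠ 0 := by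
    rw [← MvPolynomial.support_nonempty]
    exact ⟨A₀, hsuppE.2 ⟨hA₀, hA₀E⟩⟩
  have hhom {w : Fin n → ℕ} (hw : IsOrthogonalWeight c w) {D : Fin n →₀ ℕ}
      (hD : D ∈ (G * H).support) : Finsupp.weight w D = Finsupp.weight w A₀ :=
    hEw D (hsuppE.1 hD).1 (hsuppE.1 hD).2 w hw
  -- the two factors are supported on lines parallel to the edge
  obtain ⟨A, g, hg0, hg, rfl⟩ := hc.exists_eq_lineForm (left_ne_zero_of_mul hne)
    fun w hw D hD D' hD' => weight_eq_of_mem_support_of_mul w hne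
      (fun F hF F' hF' => (hhom hw hF).trans (hhom hw hF').symm) hD hD'
  obtain ⟨B, h, hh0, hh, rfl⟩ := hc.exists_eq_lineForm (right_ne_zero_of_mul hne)
    fun w hw D hD D' hD' => weight_eq_of_mem_support_of_mul w (by rwa [mul_comm])
      (fun F hF F' hF' => by
        rw [mul_comm] at hF hF'
        exact (hhom hw hF).trans (hhom hw hF').symm) hD hD'
  set G := lineForm c (fun i => (A i : ℤ)) g
  set H := lineForm c (fun i => (B i : ℤ)) h
  obtain ⟨i₀, hi₀⟩ := hc.exists_neg
  have hGw : ∀ F ∈ G.support, ∀ w, IsOrthogonalWeight c w →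
      Finsupp.weight w F = Finsupp.weight w A := by
    intro F hF w hw
    have := natCast_weight_of_mem_support_lineForm hw hg hF
    rw [← natCast_weight] at this
    exact_mod_cast this
  have hHw : ∀ F ∈ H.support, ∀ w, IsOrthogonalWeight c w →
      Finsupp.weight w F = Finsupp.weight w B := by
    intro F hF w hw
    have := natCast_weight_of_mem_support_lineForm hw hh hF
    rw [← natCast_weight] at this
    exact_mod_cast this
  have hsum {w : Fin n → ℕ} (hw : IsOrthogonalWeight c w) :
      Finsupp.weight w (A + B) = Finsupp.weight w A₀ := by
    obtain ⟨F₁, hF₁, F₂, hF₂, hF⟩ := Finset.mem_add.1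
      (MvPolynomial.support_mul _ _ (hsuppE.2 ⟨hA₀, hA₀E⟩))
    rw [← hF, map_add, map_add, hGw F₁ hF₁ w hw, hHw F₂ hF₂ w hw]
  have hAeq := eq_natDegree_mul_of_not_X_dvd hg hg0 hG
  have hcoprime : IsCoprime g h := hc.isCoprime_of_isRelPrime hg hh hg0 hcop
  -- passage to the completion
  let S := AdicCompletion (maximalIdeal R) R
  let φ : R →+* S := algebraMap R S
  let κ : ResidueField R →+* ResidueField S := ResidueField.map φ
  let y : Fin n → S := fun i => φ (x i)
  have hspan : Ideal.span (Set.range y) = maximalIdeal S := by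
    have h1 : Ideal.span (Set.range y) = (Ideal.span (Set.range x)).map φ := by
      rw [Ideal.map_span, ← Set.range_comp]
      rfl
    rw [h1, hx.span_eq]
    exact AdicCompletion.maximalIdeal_eq_map.symm
  have hy : MonomialsIndependent y := by
    have := hx.monomialsIndependent.adicCompletion
    rwa [hx.span_eq] at this
  let s : ResidueField R → S := fun a => if a = 0 then 0 else φ (residue_surjective a).choose
  have hs : s 0 = 0 := if_pos rfl
  have hκ : ∀ a, residue S (s a) = κ a := by
    intro a
    by_cases ha : a = 0
    · rw [ha, hs, map_zero, map_zero]
    · simp only [s, if_neg ha]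
      conv_rhs => rw [← (residue_surjective a).choose_spec]
      exact (ResidueField.map_residue φ _).symm
  have hf : φ f - MvPolynomial.eval y (coefficientLift s G) *
      MvPolynomial.eval y (coefficientLift s H) ∈ coneIdeal y c ω (A + B) 1 := by
    let ρE : MvPolynomial (Fin n) R :=
      ∑ D ∈ ρ.support with exponentPoint D ∈ E, MvPolynomial.monomial D (ρ.coeff D)
    have hcoeffE (D : Fin n →₀ ℕ) :
        ρE.coeff D = if exponentPoint D ∈ E then ρ.coeff D else 0 := by
      simp only [ρE, MvPolynomial.coeff_sum, MvPolynomial.coeff_monomial, Finset.sum_ite_eq',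
        Finset.mem_filter, MvPolynomial.mem_support_iff]
      by_cases h1 : ρ.coeff D = 0 <;> by_cases h2 : exponentPoint D ∈ E <;> simp [h1, h2]
    have hφf : φ f = MvPolynomial.eval y (MvPolynomial.map φ ρE) +
        MvPolynomial.eval y (MvPolynomial.map φ (ρ - ρE)) := by
      rw [← map_add, ← map_add, add_sub_cancel, ← hρ.eval_eq]
      exact MvPolynomial.map_eval φ x ρ
    have hoff : MvPolynomial.eval y (MvPolynomial.map φ (ρ - ρE)) ∈
        coneIdeal y c ω (A + B) 1 := by
      refine eval_mem_coneIdeal fun D hD => ?_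
      have hD' := MvPolynomial.support_map_subset _ _ hD
      rw [MvPolynomial.mem_support_iff, MvPolynomial.coeff_sub, hcoeffE] at hD'
      have hDE : exponentPoint D ∉ E := fun h => by simp [h] at hD'
      have hDρ : D ∈ ρ.support := by
        rw [MvPolynomial.mem_support_iff]
        intro h
        simp [h] at hD'
      refine ⟨fun w hw => by rw [hsum hw]; exact hcone D hDρ w hw, ?_⟩
      rw [hsum hωc]
      exact hstrict D hDρ hDE ω hωc hω
    have hon : MvPolynomial.eval y (MvPolynomial.map φ ρE -
        coefficientLift s G * coefficientLift s H) ∈ coneIdeal y c ω (A + B) (0 + 1) := by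
      have hweight : ∀ D ∈ (MvPolynomial.map φ ρE -
          coefficientLift s G * coefficientLift s H).support, ∀ w, IsOrthogonalWeight c w →
          Finsupp.weight w D = Finsupp.weight w (A + B) := by
        intro D hD w hw
        rcases Finset.mem_union.1 (MvPolynomial.support_sub _ _ _ hD) with hD | hD
        · have hD' := MvPolynomial.support_map_subset _ _ hD
          rw [MvPolynomial.mem_support_iff, hcoeffE] at hD'
          split_ifs at hD' with hDE
          · rw [hsum hw]
            exact hEw D (MvPolynomial.mem_support_iff.2 hD') hDE w hw
          · exact absurd rfl hD'
        · obtain ⟨F₁, hF₁, F₂, hF₂, rfl⟩ := Finset.mem_add.1 (MvPolynomial.support_mul _ _ hD)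
          rw [map_add, map_add, hGw F₁ (support_coefficientLift_subset hs _ hF₁) w hw,
            hHw F₂ (support_coefficientLift_subset hs _ hF₂) w hw]
      refine eval_mem_coneIdeal_succ hω (fun D hD => ⟨fun w hw => (hweight D hD w hw).ge,
        (hweight D hD ω hωc).ge⟩) fun D => ?_
      rw [hspan]
      refine coeff_mem_maximalIdeal_of_map_residue_eq_zero ?_ D
      rw [map_sub, map_mul, map_residue_coefficientLift hs hκ, map_residue_coefficientLift hs hκ,
        ← map_mul, ← hGH, sub_eq_zero]
      ext D
      simp only [MvPolynomial.coeff_map, hcoeffE, coeff_initialForm]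
      split_ifs
      · exact (ResidueField.map_residue φ _).symm
      · simp
    have hsplit := add_mem hon hoff
    rw [map_sub, map_mul] at hsplit
    rw [hφf]
    convert hsplit using 1
    ring
  obtain ⟨ĝ, ĥ, hfac, hĝ, hĥ⟩ := exists_mul_eq_of_division (I := maximalIdeal S) hspan hωc hω
    (fun F hF => hGw F (support_coefficientLift_subset hs _ hF))
    (fun F hF => hHw F (support_coefficientLift_subset hs _ hF))
    (fun D hD => by
      obtain ⟨b, q, hbq, hb, hq⟩ := hc.exists_monomial_eq hAeq hg0 hcoprime hg hh hD
      refine ⟨coefficientLift s b, coefficientLift s q,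
        fun F hF => hb F (support_coefficientLift_subset hs _ hF),
        fun F hF => hq F (support_coefficientLift_subset hs _ hF), fun F => ?_⟩
      refine coeff_mem_maximalIdeal_of_map_residue_eq_zero ?_ F
      simp only [map_sub, map_mul, map_residue_coefficientLift hs hκ, MvPolynomial.map_monomial,
        map_one]
      have := congrArg (MvPolynomial.map κ) hbq
      simp only [map_add, map_mul, MvPolynomial.map_monomial, map_one] at this
      rw [this]
      ring) hf
  refine ⟨ĝ, ĥ, convexHull ℝ (exponentPoint '' (G.support : Set (Fin n →₀ ℕ))),
    convexHull ℝ (exponentPoint '' (H.support : Set (Fin n →₀ ℕ))), hfac, ?_, ?_, ?_, ?_, ?_⟩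
  · exact hasInitialFormAlong_of_coefficientLift hy hspan hs hκ hω (left_ne_zero_of_mul hne)
      (fun F hF => hGw F hF ω hωc) hĝ
  · exact hasInitialFormAlong_of_coefficientLift hy hspan hs hκ hω (right_ne_zero_of_mul hne)
      (fun F hF => hHw F hF ω hωc) hĥ
  · exact faceDim_convexHull_support_lineForm_le hg0 hg hi₀.ne
  · exact faceDim_convexHull_support_lineForm_le hh0 hh hi₀.ne
  · rw [← convexHull_support_lineForm_mul hg0 hh0 hg hh hi₀.ne, hull]
    congr 2
    ext D
    rw [Finset.mem_coe]
    exact hsuppE.symm
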